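/- **Objective.** Let $N\ge 1$, $\Psi=\frac1N\sum_{i=1}^N\Psi_i$ with $\Psi,\Psi_1,\dots,\Psi_N:\mathbb R^n\to\mathbb R$ continuously differentiable. Assume that all sublevel sets of $\Psi$ are compact, that $\nabla\Psi$ is globally Lipschitz, and that the set $\mathcal Q^*$ of global minimizers of $\Psi$ equals $\{q:\nabla\Psi(q)=0\}$. **Hybrid heavy ball system.** Let $\kappa,T>0$. With state $\chi=(q,p,\tau)\in\mathbb R^n\times\mathbb R^n\times\mathbb R$ put $F_{HB}(\chi,\xi)=(p,\,-\kappa p-\xi,\,\min\{1,2-\tau/T\})$ and $G_{HB}(\chi)=(q,0,0)$. Let $\mathcal H_{HB}$ be the hybrid system $\dot\chi=F_{HB}(\chi,\nabla\Psi(q))$ for $\chi\in C_{HB}$, $\chi^+=G_{HB}(\chi)$ for $\chi\in D_{HB}$, where $C_{HB}=\{\langle\nabla\Psi(q),p\rangle\le0,\ \tau\ge T\}\cup\{\tau\le T\}$ and $D_{HB}=\{\langle\nabla\Psi(q),p\rangle\ge0,\ \tau\ge T\}$. Let $\mathcal M=\mathcal Q^*\times\{0\}\times[0,2T]$. **Hybrid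 sequences.** A hybrid sequence domain is the union of a nondecreasing sequence of sets of the form $\bigcup_{j=0}^{J-1}\{k_j,\dots,k_{j+1}\}\times\{j\}\subset\mathbb Z_{\ge0}^2$ with $J\ge1$ and $0=k_0\le k_1\le\dots\le k_J$; a hybrid sequence $\phi$ is a map from such a domain to a Euclidean space. It is complete if its domain is unbounded, and complete in the $k$-direction ($j$-direction) if the set of all $k$'s (of all $j$'s) occurring in the domain is unbounded. Put $\bar\jmath_k=\inf\{j:(k+1,j)\in\operatorname{dom}\phi\}$ and $\bar k_j=\inf\{k:(k,j+1)\in\operatorname{dom}\phi\}$. Its $\omega$-limit set is $\bigcap_{i}\overline{\{\phi(k,j):(k,j)\in\operatorname{dom}\phi,\ k+j\ge i\}}$. **Asymptotic simulations.** Step sizes $\{h_k\}_{k\ge1}$ are admissible if $h_k>0$, $h_k\to0$ and $\sum_k h_k=\infty$; put $\tau_k=\sum_{i=1}^k h_i$ and $m(t)=\max\{k:\tau_k\le t\}$. The pair $(\phi,\{h_k\})$ is an asymptotic simulation of a hybrid system with flow set $C$, flow map $F$, jump set $D$ and jump map $G$ if $\phi$ is a bounded and complete hybrid sequence, $\{h_k\}$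 is admissible, and: 1. if $\phi$ is complete in the $k$-direction, there is a bounded sequence $\{f_k\}_{k\ge0}$ such that every accumulation point $(x,f)$ of $(\phi(k,\bar\jmath_k),f_k)$ as $k\to\infty$ satisfies $x\in C$ and $f\in F(x)$, and, for every $S>0$, $$\lim_{n\to\infty}\ \sup_{n+1\le k\le m(\tau_n+S)}\Big|\sum_{i=n}^{k-1}h_{i+1}\Big(\tfrac{\phi(i+1,\bar\jmath_i)-\phi(i,\bar\jmath_i)}{h_{i+1}}-f_i\Big)\Big|=0;$$ 2. if $\phi$ is complete in the $j$-direction, every accumulation point $(x,g)$ of $(\phi(\bar k_j,j),\phi(\bar k_j,j+1))$ as $j\to\infty$ satisfies $x\in D$ and $g\in G(x)$. **Simulator.** Let $\{h_{s,k}\}_{k\ge1}$ and $\{h_{f,k}\}_{k\ge1}$ be admissible with $h_{s,k}/h_{f,k}\to0$ and $\sum_k h_{f,k}^{1+\rho}<\infty$ for some $\rho\in[1,\infty)$. On a probability space $(\Omega,\mathcal F,\mathbb P)$ let $y_1,y_2,\dots$ be i.i.d. uniform on $\{1,\dots,N\}$, and let $\mathcal F_k=\sigma(y_1,\dots,y_k)$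 ($\mathcal F_0$ trivial). Put $C=\{(\chi,\xi):\langle\xi,p\rangle\le0,\ \tau\ge T\}\cup\{\tau\le T\}$ and $D=\{(\chi,\xi):\langle\xi,p\rangle\ge0,\ \tau\ge T\}$. Let $X=(x_s,x_f)$ be a solution of the simulator, i.e. for every $\omega\in\Omega$, $X(\omega)$ is a complete hybrid sequence in $\mathbb R^{2n+1}\times\mathbb R^n$ such that - if $(k,j),(k+1,j)\in\operatorname{dom}X(\omega)$, then $X(k,j)\in C$, $x_s(k+1,j)-x_s(k,j)=h_{s,k+1}F_{HB}(x_s(k,j),x_f(k,j))$ and $x_f(k+1,j)-x_f(k,j)=h_{f,k+1}\big(\nabla\Psi_{y_{k+1}}(q(k,j))-x_f(k,j)\big)$, where $q(k,j)$ is the $q$-component of $x_s(k,j)$; - if $(k,j),(k,j+1)\in\operatorname{dom}X(\omega)$, then $X(k,j)\in D$, $x_s(k,j+1)=G_{HB}(x_s(k,j))$ and $x_f(k,j+1)=x_f(k,j)$; and $X$ is adapted: for each $k$, the set-valued map $\omega\mapsto\{(k,j,X(\omega)(k,j)):(k,j)\in\operatorname{dom}X(\omega)\}$ is $\mathcal F_k$-measurable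 (the event that it meets a given open set is in $\mathcal F_k$). **Theorem.** Let $\hat\Omega\subset\Omega$ be such that $X(\omega)$ is bounded and complete for almost every $\omega\in\hat\Omega$. Then, for almost every $\omega\in\hat\Omega$, the pair $(x_s(\omega),\{h_{s,k}\}_{k\ge1})$ is an asymptotic simulation of $\mathcal H_{HB}$, and the $\omega$-limit set of the hybrid sequence $x_s(\omega)$ is contained in $\mathcal M$. -/

import Mathlib

open Filter Topology MeasureTheory ProbabilityTheory
open scoped Gradient NNReal ENNReal

noncomputable section

/-! ### Hybrid inclusions -/

/-- The data `(C, F, D, G)` of a hybrid inclusion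
`x ∈ C, ẋ ∈ F(x)`; `x ∈ D, x⁺ ∈ G(x)`. -/
structure HybridInclusion (E : Type*) where
  /-- flow set -/
  C : Set E
  /-- flow map -/
  F : E → Set E
  /-- jump set -/
  D : Set E
  /-- jump map -/
  G : E → Set E

namespace HybridInclusion

variable {E : Type*}

/-- The graph of `F_C`, the flow map restricted to the flow set. -/
def graphFC (H : HybridInclusion E) : Set (E × E) :=
  {z | z.1 ∈ H.C ∧ z.2 ∈ H.F z.1}

/-- The graph of `G_D`, the jump map restricted to the jump set. -/
def graphGD (H : HybridInclusion E) : Set (E × E) :=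
  {z | z.1 ∈ H.D ∧ z.2 ∈ H.G z.1}

end HybridInclusion

/-! ### Hybrid sequences -/

/-- `E = ⋃_{j=0}^{J-1} {k_j, …, k_{j+1}} × {j}` with `0 = k_0 ≤ k_1 ≤ … ≤ k_J` and `J ≥ 1`.
Points of `ℕ × ℕ` are written `(k, j)`. -/
def IsCompactHybridSeqDomain (E : Set (ℕ × ℕ)) : Prop :=
  ∃ (J : ℕ) (κ : ℕ → ℕ), 1 ≤ J ∧ κ 0 = 0 ∧ (∀ i < J, κ i ≤ κ (i + 1)) ∧
    E = {z | z.2 < J ∧ κ z.2 ≤ z.1 ∧ z.1 ≤ κ (z.2 + 1)}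

/-- The union of a nondecreasing sequence of compact hybrid sequence domains. -/
def IsHybridSeqDomain (E : Set (ℕ × ℕ)) : Prop :=
  ∃ S : ℕ → Set (ℕ × ℕ), (∀ i, IsCompactHybridSeqDomain (S i)) ∧ Monotone S ∧ E = ⋃ i, S i

/-- A hybrid sequence. Only the values of `val` at points of `dom` are meaningful, and no
definition below looks at the others. -/
structure HybridSeq (E : Type*) where
  dom : Set (ℕ × ℕ)
  isDomain : IsHybridSeqDomain dom
  val : ℕ → ℕ → E

namespace HybridSeq

variable {E E' : Type*}

/-- The domain is unbounded. -/
def IsComplete (φ : HybridSeq E) : Prop :=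
  ∀ m : ℕ, ∃ z ∈ φ.dom, m ≤ z.1 + z.2

/-- Complete in the `k`-direction. -/
def IsCompleteK (φ : HybridSeq E) : Prop :=
  ∀ m : ℕ, ∃ z ∈ φ.dom, m ≤ z.1

/-- Complete in the `j`-direction. -/
def IsCompleteJ (φ : HybridSeq E) : Prop :=
  ∀ m : ℕ, ∃ z ∈ φ.dom, m ≤ z.2

/-- The set of values on the part of the domain where `k + j ≥ i`. -/
def tailRange (φ : HybridSeq E) (i : ℕ) : Set E :=
  {x | ∃ z ∈ φ.dom, i ≤ z.1 + z.2 ∧ x = φ.val z.1 z.2}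

/-- The set of all values is bounded. -/
def IsBounded [Bornology E] (φ : HybridSeq E) : Prop :=
  Bornology.IsBounded (φ.tailRange 0)

/-- The index of the row in which the sequence passes from `k` to `k + 1`. It is used only
for sequences that are complete in the `k`-direction, where the infimum is over a
nonempty set. -/
def jbar (φ : HybridSeq E) (k : ℕ) : ℕ :=
  sInf {j | (k + 1, j) ∈ φ.dom}

/-- The index of the column in which the sequence passes from `j` to `j + 1`. It is used only
for sequences that are complete in the `j`-direction, where the infimum is over a
nonempty set. -/
def kbar (φ : HybridSeq E) (j : ℕ) : ℕ :=
  sInf {k | (k, j + 1) ∈ φ.dom}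

/-- The `ω`-limit set: the Painlevé–Kuratowski limit as `i → ∞` of the nonincreasing sequence
of sets `{φ(k,j) : (k,j) ∈ dom φ, k + j ≥ i}`, which is the intersection of the closures. -/
def omegaLim [TopologicalSpace E] (φ : HybridSeq E) : Set E :=
  ⋂ i : ℕ, closure (φ.tailRange i)

/-- The image of a hybrid sequence under a map of the state space. -/
def map (f : E → E') (φ : HybridSeq E) : HybridSeq E' where
  dom := φ.dom
  isDomain := φ.isDomain
  val := fun k j => f (φ.val k j)

end HybridSeq

/-! ### Step sizes and asymptotic simulations

A sequence of step sizes `h_1, h_2, …` is a function `h : ℕ → ℝ` whose value at `0` is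
never used. -/

/-- Positive, convergent to zero, not summable. -/
structure AdmissibleSteps (h : ℕ → ℝ) : Prop where
  pos : ∀ k, 1 ≤ k → 0 < h k
  tendsto_zero : Tendsto h atTop (𝓝 0)
  not_summable : ¬ Summable (fun k => h (k + 1))

/-- `τ_k = h_1 + ⋯ + h_k`. -/
def stepTime (h : ℕ → ℝ) (k : ℕ) : ℝ :=
  ∑ i ∈ Finset.range k, h (i + 1)

/-- `m(t) = max {k : τ_k ≤ t}`; for admissible steps and `t ≥ 0` this set of natural numbers
is nonempty and finite. -/
def stepIndex (h : ℕ → ℝ) (t : ℝ) : ℕ :=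
  sSup {k | stepTime h k ≤ t}

/-- The outer limit of a sequence of points: the set of its accumulation points. -/
def outerLimit {E : Type*} [TopologicalSpace E] (u : ℕ → E) : Set E :=
  {z | MapClusterPt z atTop u}

/-- The pair `(φ, h)` is an asymptotic simulation of `H`. The supremum of norms is a finite
supremum in `ℝ≥0`, equal to `0` when the index set is empty. -/
structure IsAsymptoticSimulation {E : Type*} [NormedAddCommGroup E] [NormedSpace ℝ E]
    (H : HybridInclusion E) (φ : HybridSeq E) (h : ℕ → ℝ) : Prop where
  bounded : φ.IsBounded
  complete : φ.IsComplete
  admissible : AdmissibleSteps h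
  flow : φ.IsCompleteK →
    ∃ f : ℕ → E, Bornology.IsBounded (Set.range f) ∧
      outerLimit (fun k => (φ.val k (φ.jbar k), f k)) ⊆ H.graphFC ∧
      ∀ T : ℝ, 0 < T →
        Tendsto
          (fun n => (Finset.Icc (n + 1) (stepIndex h (stepTime h n + T))).sup
            (fun k => ‖∑ i ∈ Finset.Ico n k, h (i + 1) •
              ((h (i + 1))⁻¹ • (φ.val (i + 1) (φ.jbar i) - φ.val i (φ.jbar i)) - f i)‖₊))
          atTop (𝓝 (0 : ℝ≥0))
  jump : φ.IsCompleteJ →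
    outerLimit (fun j => (φ.val (φ.kbar j) j, φ.val (φ.kbar j) (j + 1))) ⊆ H.graphGD

/-- Two-timescale admissible step sizes `H_k = (hs k, hf k)`, `k ≥ 1`. -/
structure TwoTimescaleAdmissible (hs hf : ℕ → ℝ) : Prop where
  slow : AdmissibleSteps hs
  fast : AdmissibleSteps hf
  separation : Tendsto (fun k => hs k / hf k) atTop (𝓝 0)

/-- Two-timescale admissible, with `∑ hf_k ^ (1 + p) < ∞` for some `p ∈ [1, ∞)`. -/
structure SimulatorSteps (hs hf : ℕ → ℝ) : Prop where
  admissible : TwoTimescaleAdmissible hs hf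
  summable : ∃ p : ℝ, 1 ≤ p ∧ Summable (fun k => hf (k + 1) ^ (1 + p))

/-! ### The objective function -/

/-- The set of global minimizers of `Ψ`. -/
def minimizers {n : ℕ} (Ψ : EuclideanSpace ℝ (Fin n) → ℝ) : Set (EuclideanSpace ℝ (Fin n)) :=
  {q | ∀ q', Ψ q ≤ Ψ q'}

/-- The standing assumptions on the objective `Ψ = (1/N) ∑ Ψ_i`. -/
structure ObjectiveAssumption {n N : ℕ} (Ψ : EuclideanSpace ℝ (Fin n) → ℝ)
    (Ψi : Fin N → EuclideanSpace ℝ (Fin n) → ℝ) : Prop where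
  contDiff : ContDiff ℝ 1 Ψ
  compact_sublevel : ∀ c : ℝ, IsCompact {q | Ψ q ≤ c}
  lipschitz_gradient : ∃ L : ℝ≥0, LipschitzWith L (∇ Ψ)
  minimizers_eq : minimizers Ψ = {q | ∇ Ψ q = 0}
  one_le : 1 ≤ N
  contDiff_summand : ∀ i, ContDiff ℝ 1 (Ψi i)
  eq_average : ∀ q, Ψ q = (1 / (N : ℝ)) * ∑ i, Ψi i q

/-! ### The hybrid heavy ball system and its two-timescale simulator

The slow state is `χ = (q, p, τ)`, the fast state is `ξ`. Products carry Mathlib's product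
norm, which is equivalent to the Euclidean norm; only boundedness and convergence in the
product spaces are used. -/

/-- The slow state space `ℝⁿ × ℝⁿ × ℝ`, with points `χ = (q, p, τ)`. -/
abbrev SlowState (n : ℕ) : Type :=
  EuclideanSpace ℝ (Fin n) × EuclideanSpace ℝ (Fin n) × ℝ

/-- The full state space, with points `(χ, ξ)`. -/
abbrev FullState (n : ℕ) : Type :=
  SlowState n × EuclideanSpace ℝ (Fin n)

/-- `F_HB(χ, ξ) = (p, -κ p - ξ, min {1, 2 - τ / T})`. -/
def flowHB {n : ℕ} (κ T : ℝ) (χ : SlowState n) (ξ : EuclideanSpace ℝ (Fin n)) : SlowState n :=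
  (χ.2.1, -(κ • χ.2.1) - ξ, min 1 (2 - χ.2.2 / T))

/-- `G_HB(χ) = (q, 0, 0)`. -/
def jumpHB {n : ℕ} (χ : SlowState n) : SlowState n :=
  (χ.1, 0, 0)

/-- The flow set of the simulator:
`{⟨ξ, p⟩ ≤ 0, τ ≥ T} ∪ {τ ≤ T}`. -/
def simC {n : ℕ} (T : ℝ) : Set (FullState n) :=
  {x | inner ℝ x.2 x.1.2.1 ≤ 0 ∧ T ≤ x.1.2.2} ∪ {x | x.1.2.2 ≤ T}

/-- The jump set of the simulator: `{⟨ξ, p⟩ ≥ 0, τ ≥ T}`. -/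
def simD {n : ℕ} (T : ℝ) : Set (FullState n) :=
  {x | 0 ≤ inner ℝ x.2 x.1.2.1 ∧ T ≤ x.1.2.2}

/-- The hybrid heavy ball system `H_HB`. -/
def heavyBall {n : ℕ} (Ψ : EuclideanSpace ℝ (Fin n) → ℝ) (κ T : ℝ) :
    HybridInclusion (SlowState n) where
  C := {χ | inner ℝ (∇ Ψ χ.1) χ.2.1 ≤ 0 ∧ T ≤ χ.2.2} ∪ {χ | χ.2.2 ≤ T}
  F := fun χ => {flowHB κ T χ (∇ Ψ χ.1)}
  D := {χ | 0 ≤ inner ℝ (∇ Ψ χ.1) χ.2.1 ∧ T ≤ χ.2.2}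
  G := fun χ => {jumpHB χ}

/-- `𝓜 = Q* × {0} × [0, 2T]`. -/
def attractorHB {n : ℕ} (Ψ : EuclideanSpace ℝ (Fin n) → ℝ) (T : ℝ) : Set (SlowState n) :=
  minimizers Ψ ×ˢ ({0} ×ˢ Set.Icc 0 (2 * T))

/-! ### The random index sequence and solutions of the simulator -/

/-- `y_1, y_2, …` are independent and uniformly distributed on the index set `Fin N` (standing
for `{1, …, N}`); `y 0` is never used. -/
structure IsUniformIID {Ω : Type*} [MeasurableSpace Ω] (P : Measure Ω) {N : ℕ}
    (y : ℕ → Ω → Fin N) : Prop where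
  measurable : ∀ k, 1 ≤ k → Measurable (y k)
  indep : iIndepFun (fun k => y (k + 1)) P
  uniform : ∀ k, 1 ≤ k → ∀ i, P {ω | y k ω = i} = (N : ℝ≥0∞)⁻¹

/-- The minimal filtration: `𝓕_k = σ(y_1, …, y_k)`, with `𝓕_0` trivial. -/
def indexFiltration {Ω : Type*} {N : ℕ} (y : ℕ → Ω → Fin N) (k : ℕ) : MeasurableSpace Ω :=
  ⨆ i ∈ Finset.Icc 1 k, MeasurableSpace.comap (y i) inferInstance

/-- Measurability of a (closed-valued) set-valued mapping: preimages of open sets are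
measurable. -/
def SetValuedMeasurable {Ω E : Type*} [TopologicalSpace E] (m : MeasurableSpace Ω)
    (S : Ω → Set E) : Prop :=
  ∀ O : Set E, IsOpen O → MeasurableSet[m] {ω | (S ω ∩ O).Nonempty}

/-- The part of the graph of a hybrid sequence that lies over the given `k`. -/
def HybridSeq.graphAt {E : Type*} (φ : HybridSeq E) (k : ℕ) : Set (ℕ × ℕ × E) :=
  {z | z.1 = k ∧ (z.1, z.2.1) ∈ φ.dom ∧ z.2.2 = φ.val z.1 z.2.1}

/-- `X` is a solution of the two-timescale simulator driven by `y`: an adapted collection of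
complete sample paths each of which obeys the flow and jump constraints. -/
structure IsSimulatorSolution {n N : ℕ} {Ω : Type*}
    (Ψi : Fin N → EuclideanSpace ℝ (Fin n) → ℝ) (κ T : ℝ) (hs hf : ℕ → ℝ)
    (y : ℕ → Ω → Fin N) (X : Ω → HybridSeq (FullState n)) : Prop where
  adapted : ∀ k, SetValuedMeasurable (indexFiltration y k) (fun ω => (X ω).graphAt k)
  complete : ∀ ω, (X ω).IsComplete
  flow : ∀ ω k j, (k, j) ∈ (X ω).dom → (k + 1, j) ∈ (X ω).dom →
    (X ω).val k j ∈ simC T ∧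
    (hs (k + 1))⁻¹ • (((X ω).val (k + 1) j).1 - ((X ω).val k j).1) =
      flowHB κ T ((X ω).val k j).1 ((X ω).val k j).2 ∧
    (hf (k + 1))⁻¹ • (((X ω).val (k + 1) j).2 - ((X ω).val k j).2) =
      ∇ (Ψi (y (k + 1) ω)) ((X ω).val k j).1.1 - ((X ω).val k j).2
  jump : ∀ ω k j, (k, j) ∈ (X ω).dom → (k, j + 1) ∈ (X ω).dom →
    (X ω).val k j ∈ simD T ∧
    ((X ω).val k (j + 1)).1 = jumpHB ((X ω).val k j).1 ∧
    ((X ω).val k (j + 1)).2 = ((X ω).val k j).2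

end

/-! The proof separates a probabilistic fact from a deterministic one.

Reduction. A jump resets the timer to `0 < T`, so two jumps never follow each other. Hence `j ≤ k +
1` on the domain, every complete path is complete in the `k`-direction, and it is described by the
states `flowStart k` and `flowEnd k` around the `k`-th flow step.

Tracking (`tracking`). The error `ξ - ∇Ψ(q)` is contracted at rate `hf`, and it is driven by the
sampling noise and by the change of `∇Ψ(q)`. On a bounded path that change is `O(hs) = o(hf)`. The
noise enters through an exponential average of bounded martingale differences. The moment of order
`2r + 2` of this average obeys a damped recursion with error `O(hf ^ (r + 2))`, which is summable.
So this power converges almost surely, as a supermartingale up to a vanishing correction, and its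
limit is zero because its mean tends to zero (`exponential_average_tendsto_zero`). Thus the error
vanishes almost surely on bounded paths.

Lyapunov argument. The rest is pathwise. The function `Ψ + |p|²/2 + c⟨∇Ψ, p⟩ + bτ` with small `c, b
> 0` dissipates both `|p|²` and `|∇Ψ|²` during flow (`crossEnergy_flow_le`). At a jump the cross
term may raise it by `c²/2` times the squared tracking error, but the reset of `τ` lowers it by at
least `bT` (`energy_step`). All critical points lie at the minimal level of `Ψ`, so dissipation is
uniform away from that level. As `∑ hs = ∞`, the energy sinks to it, and no invariance principle is
needed. The asymptotic simulation property follows from tracking, since the simulator's flow and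
jump sets are closed and its maps continuous. -/

/-! ### Hybrid sequence domains -/

namespace IsCompactHybridSeqDomain

theorem zero_mem {E : Set (ℕ × ℕ)} (h : IsCompactHybridSeqDomain E) : (0, 0) ∈ E := by
  obtain ⟨J, κ, hJ, h0, -, rfl⟩ := h
  exact ⟨hJ, h0.le, Nat.zero_le _⟩

theorem endpoints_mono {J : ℕ} {κ : ℕ → ℕ} (hκ : ∀ i < J, κ i ≤ κ (i + 1)) {a b : ℕ}
    (hab : a ≤ b) (hb : b ≤ J) : κ a ≤ κ b := by
  induction b, hab using Nat.le_induction with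
  | base => exact le_rfl
  | succ b _ ih => exact (ih (by omega)).trans (hκ b (by omega))

theorem le_of_lt {E : Set (ℕ × ℕ)} (h : IsCompactHybridSeqDomain E) {k j k' j' : ℕ}
    (hz : (k, j) ∈ E) (hz' : (k', j') ∈ E) (hj : j < j') : k ≤ k' := by
  obtain ⟨J, κ, hJ, h0, hκ, rfl⟩ := h
  obtain ⟨h1, h2, h3⟩ := hz
  obtain ⟨h1', h2', h3'⟩ := hz'
  exact h3.trans ((endpoints_mono hκ hj h1'.le).trans h2')

theorem column_convex {E : Set (ℕ × ℕ)} (h : IsCompactHybridSeqDomain E) {k j i j' : ℕ}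
    (hz : (k, j) ∈ E) (hz' : (k, j') ∈ E) (hji : j ≤ i) (hij : i ≤ j') : (k, i) ∈ E := by
  rcases hji.eq_or_lt with rfl | hji
  · exact hz
  obtain ⟨J, κ, hJ, h0, hκ, rfl⟩ := h
  obtain ⟨h1, h2, h3⟩ := hz
  obtain ⟨h1', h2', h3'⟩ := hz'
  simp only at h1 h2 h3 h1' h2' h3'
  exact ⟨by simp only; omega, (endpoints_mono hκ hij h1'.le).trans h2',
    h3.trans (endpoints_mono hκ (by simp only; omega) (by simp only; omega))⟩

/-- If `k + 1` is the left end of row `j`, then `j ≥ 1` because `κ 0 = 0`, and the row below ends,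
at the right, in that column. Thus the lowest row that reaches column `k + 1` also contains column
`k`. -/
theorem left_or_below {E : Set (ℕ × ℕ)} (h : IsCompactHybridSeqDomain E) {k j : ℕ}
    (hz : (k + 1, j) ∈ E) : (k, j) ∈ E ∨ ∃ i < j, (k + 1, i) ∈ E := by
  obtain ⟨J, κ, hJ, h0, hκ, rfl⟩ := h
  obtain ⟨h1, h2, h3⟩ := hz
  simp only at h1 h2 h3
  by_cases hk : κ j ≤ k
  · exact Or.inl ⟨h1, hk, by simp only; omega⟩
  · right
    cases j with
    | zero => omega
    | succ i =>
      have := hκ i (by omega)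
      exact ⟨i, by omega, by simp only; omega, by simp only; omega, by simp only; omega⟩

theorem below_or_left {E : Set (ℕ × ℕ)} (h : IsCompactHybridSeqDomain E) {k j : ℕ}
    (hz : (k, j + 1) ∈ E) : (k, j) ∈ E ∨ ∃ i < k, (i, j + 1) ∈ E := by
  obtain ⟨J, κ, hJ, h0, hκ, rfl⟩ := h
  obtain ⟨h1, h2, h3⟩ := hz
  simp only at h1 h2 h3
  have := hκ j (by omega)
  have := hκ (j + 1) (by omega)
  rcases h2.eq_or_lt with h2 | h2
  · exact Or.inl ⟨by simp only; omega, by simp only; omega, by simp only; omega⟩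
  · exact Or.inr ⟨_, h2, h1, le_rfl, by simp only; omega⟩

end IsCompactHybridSeqDomain

namespace IsHybridSeqDomain

variable {E : Set (ℕ × ℕ)}

theorem exists_compact (h : IsHybridSeqDomain E) {z z' : ℕ × ℕ} (hz : z ∈ E) (hz' : z' ∈ E) :
    ∃ S ⊆ E, IsCompactHybridSeqDomain S ∧ z ∈ S ∧ z' ∈ S := by
  obtain ⟨S, hS, hmono, rfl⟩ := h
  obtain ⟨i, hi⟩ := Set.mem_iUnion.1 hz
  obtain ⟨i', hi'⟩ := Set.mem_iUnion.1 hz'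
  exact ⟨S (max i i'), Set.subset_iUnion _ _, hS _, hmono (le_max_left _ _) hi,
    hmono (le_max_right _ _) hi'⟩

theorem zero_mem (h : IsHybridSeqDomain E) : (0, 0) ∈ E := by
  obtain ⟨S, hS, hmono, rfl⟩ := h
  exact Set.mem_iUnion.2 ⟨0, (hS 0).zero_mem⟩

theorem le_of_lt (h : IsHybridSeqDomain E) {k j k' j' : ℕ}
    (hz : (k, j) ∈ E) (hz' : (k', j') ∈ E) (hj : j < j') : k ≤ k' := by
  obtain ⟨S, -, hS, h1, h2⟩ := h.exists_compact hz hz'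
  exact hS.le_of_lt h1 h2 hj

theorem column_convex (h : IsHybridSeqDomain E) {k j i j' : ℕ}
    (hz : (k, j) ∈ E) (hz' : (k, j') ∈ E) (hji : j ≤ i) (hij : i ≤ j') : (k, i) ∈ E := by
  obtain ⟨S, hSE, hS, h1, h2⟩ := h.exists_compact hz hz'
  exact hSE (hS.column_convex h1 h2 hji hij)

theorem left_or_below (h : IsHybridSeqDomain E) {k j : ℕ}
    (hz : (k + 1, j) ∈ E) : (k, j) ∈ E ∨ ∃ i < j, (k + 1, i) ∈ E := by
  obtain ⟨S, hSE, hS, h1, -⟩ := h.exists_compact hz hz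
  exact (hS.left_or_below h1).imp (fun h => hSE h) fun ⟨i, hi, h⟩ => ⟨i, hi, hSE h⟩

theorem below_or_left (h : IsHybridSeqDomain E) {k j : ℕ}
    (hz : (k, j + 1) ∈ E) : (k, j) ∈ E ∨ ∃ i < k, (i, j + 1) ∈ E := by
  obtain ⟨S, hSE, hS, h1, -⟩ := h.exists_compact hz hz
  exact (hS.below_or_left h1).imp (fun h => hSE h) fun ⟨i, hi, h⟩ => ⟨i, hi, hSE h⟩

end IsHybridSeqDomain

/-! ### Transitions between rows and columns; sequences without double jumps -/

namespace HybridSeq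

variable {E : Type*} {φ : HybridSeq E}

theorem jbar_succ_mem {k j : ℕ} (h : (k + 1, j) ∈ φ.dom) : (k + 1, φ.jbar k) ∈ φ.dom :=
  Nat.sInf_mem (s := {j | (k + 1, j) ∈ φ.dom}) ⟨j, h⟩

theorem jbar_le {k j : ℕ} (h : (k + 1, j) ∈ φ.dom) : φ.jbar k ≤ j :=
  Nat.sInf_le (s := {j | (k + 1, j) ∈ φ.dom}) h

theorem jbar_mem {k j : ℕ} (h : (k + 1, j) ∈ φ.dom) : (k, φ.jbar k) ∈ φ.dom := by
  rcases φ.isDomain.left_or_below (jbar_succ_mem h) with h' | ⟨i, hi, h'⟩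
  · exact h'
  · exact absurd (jbar_le h') (by omega)

theorem kbar_mem {k j : ℕ} (h : (k, j + 1) ∈ φ.dom) :
    (φ.kbar j, j) ∈ φ.dom ∧ (φ.kbar j, j + 1) ∈ φ.dom := by
  have h1 : (φ.kbar j, j + 1) ∈ φ.dom := Nat.sInf_mem (s := {k | (k, j + 1) ∈ φ.dom}) ⟨k, h⟩
  refine ⟨?_, h1⟩
  rcases φ.isDomain.below_or_left h1 with h' | ⟨i, hi, h'⟩
  · exact h'
  · have : φ.kbar j ≤ i := Nat.sInf_le (s := {k | (k, j + 1) ∈ φ.dom}) h'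
    omega

/-- No two consecutive jumps. -/
def NoDoubleJump (φ : HybridSeq E) : Prop :=
  ∀ k j, (k, j) ∈ φ.dom → (k, j + 2) ∉ φ.dom

theorem NoDoubleJump.column {k j j' : ℕ} (hφ : φ.NoDoubleJump) (h : (k, j) ∈ φ.dom)
    (h' : (k, j') ∈ φ.dom) (hj : j ≤ j') : j' = j ∨ j' = j + 1 := by
  by_contra hne
  exact hφ k j h (φ.isDomain.column_convex h h' (by omega) (by omega))

/-- Each column meets at most two rows, and the lower one is already present in the previous column,
so each column adds at most one row. -/
theorem NoDoubleJump.le_succ (hφ : φ.NoDoubleJump) {k j : ℕ} (h : (k, j) ∈ φ.dom) :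
    j ≤ k + 1 := by
  induction k generalizing j with
  | zero =>
    rcases hφ.column φ.isDomain.zero_mem h (Nat.zero_le _) with h | h <;> omega
  | succ k ih =>
    have h1 := ih (jbar_mem h)
    rcases hφ.column (jbar_succ_mem h) h (jbar_le h) with h | h <;> omega

theorem NoDoubleJump.isCompleteK (hφ : φ.NoDoubleJump) (h : φ.IsComplete) :
    φ.IsCompleteK := by
  intro m
  obtain ⟨⟨k, j⟩, hz, hm⟩ := h (2 * m + 1)
  have := hφ.le_succ hz
  exact ⟨(k, j), hz, by simp only at hm ⊢; omega⟩

theorem IsCompleteK.exists_mem (h : φ.IsCompleteK) (k : ℕ) : ∃ j, (k, j) ∈ φ.dom := by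
  obtain ⟨⟨k', j⟩, hz, hk⟩ := h k
  have key : ∀ d k j, (k + d, j) ∈ φ.dom → ∃ j, (k, j) ∈ φ.dom := by
    intro d
    induction d with
    | zero => exact fun k j h => ⟨j, h⟩
    | succ d ih => exact fun k j h => ih k _ (jbar_mem h)
  obtain ⟨d, rfl⟩ := Nat.exists_eq_add_of_le hk
  exact key d k j hz

theorem IsCompleteK.jbar_mem (h : φ.IsCompleteK) (k : ℕ) :
    (k, φ.jbar k) ∈ φ.dom ∧ (k + 1, φ.jbar k) ∈ φ.dom := by
  obtain ⟨j, hj⟩ := h.exists_mem (k + 1)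
  exact ⟨HybridSeq.jbar_mem hj, jbar_succ_mem hj⟩

theorem IsCompleteJ.kbar_mem (h : φ.IsCompleteJ) (j : ℕ) :
    (φ.kbar j, j) ∈ φ.dom ∧ (φ.kbar j, j + 1) ∈ φ.dom := by
  obtain ⟨⟨k', j'⟩, hz, hj⟩ := h (j + 1)
  have key : ∀ d j k, (k, j + d) ∈ φ.dom → ∃ k, (k, j) ∈ φ.dom := by
    intro d
    induction d with
    | zero => exact fun j k h => ⟨k, h⟩
    | succ d ih => exact fun j k h => ih j _ (HybridSeq.kbar_mem h).1
  obtain ⟨d, rfl⟩ := Nat.exists_eq_add_of_le hj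
  obtain ⟨k, hk⟩ := key d (j + 1) k' hz
  exact HybridSeq.kbar_mem hk

theorem IsCompleteK.le_jbar (h : φ.IsCompleteK) {k j : ℕ} (hz : (k, j) ∈ φ.dom) :
    j ≤ φ.jbar k := by
  by_contra hlt
  have := φ.isDomain.le_of_lt (h.jbar_mem k).2 hz (by omega)
  omega

theorem NoDoubleJump.jbar_cases (hφ : φ.NoDoubleJump) (h : φ.IsCompleteK) {k j : ℕ}
    (hz : (k, j) ∈ φ.dom) : φ.jbar k = j ∨ φ.jbar k = j + 1 :=
  hφ.column hz (h.jbar_mem k).1 (h.le_jbar hz)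

/-- Every point of column `k + 1` is reached by the flow, or is left by the flow. -/
theorem NoDoubleJump.eq_jbar_or (hφ : φ.NoDoubleJump) (h : φ.IsCompleteK) {k j : ℕ}
    (hz : (k + 1, j) ∈ φ.dom) : j = φ.jbar k ∨ j = φ.jbar (k + 1) := by
  have h1 := h.le_jbar hz
  have h2 := jbar_le hz
  rcases hφ.jbar_cases h (h.jbar_mem k).2 with h3 | h3 <;> omega

end HybridSeq

/-! ### Sample paths of the simulator -/

namespace IsSimulatorSolution

variable {n N : ℕ} {Ω : Type*} {Ψi : Fin N → EuclideanSpace ℝ (Fin n) → ℝ} {κ T : ℝ}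
  {hs hf : ℕ → ℝ} {y : ℕ → Ω → Fin N} {X : Ω → HybridSeq (FullState n)}

theorem noDoubleJump (hX : IsSimulatorSolution Ψi κ T hs hf y X) (hT : 0 < T) (ω : Ω) :
    (X ω).NoDoubleJump := by
  intro k j h0 h2
  have h1 := (X ω).isDomain.column_convex h0 h2 (Nat.le_succ j) (by omega)
  have e := (hX.jump ω k j h0 h1).2.1
  have d := (hX.jump ω k (j + 1) h1 h2).1.2
  rw [e] at d
  exact absurd d (not_le.2 hT)

theorem isCompleteK (hX : IsSimulatorSolution Ψi κ T hs hf y X) (hT : 0 < T) (ω : Ω) :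
    (X ω).IsCompleteK :=
  (hX.noDoubleJump hT ω).isCompleteK (hX.complete ω)

end IsSimulatorSolution

/-- The state from which the sequence passes from `k` to `k + 1`. -/
noncomputable def HybridSeq.flowStart {E : Type*} (φ : HybridSeq E) (k : ℕ) : E := φ.val k (φ.jbar k)

/-- The state which the sequence reaches when it passes from `k` to `k + 1`. -/
noncomputable def HybridSeq.flowEnd {E : Type*} (φ : HybridSeq E) (k : ℕ) : E := φ.val (k + 1) (φ.jbar k)

namespace IsSimulatorSolution

variable {n N : ℕ} {Ω : Type*} {Ψi : Fin N → EuclideanSpace ℝ (Fin n) → ℝ} {κ T : ℝ}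
  {hs hf : ℕ → ℝ} {y : ℕ → Ω → Fin N} {X : Ω → HybridSeq (FullState n)}

theorem flowStart_mem (hX : IsSimulatorSolution Ψi κ T hs hf y X) (hT : 0 < T) (ω : Ω)
    (k : ℕ) : (X ω).flowStart k ∈ simC T :=
  have h := (hX.isCompleteK hT ω).jbar_mem k
  (hX.flow ω k _ h.1 h.2).1

theorem flowEnd_fst (hX : IsSimulatorSolution Ψi κ T hs hf y X) (hT : 0 < T)
    (hpos : ∀ k, 1 ≤ k → 0 < hs k) (ω : Ω) (k : ℕ) :
    ((X ω).flowEnd k).1 = ((X ω).flowStart k).1 +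
      hs (k + 1) • flowHB κ T ((X ω).flowStart k).1 ((X ω).flowStart k).2 := by
  have h := (hX.isCompleteK hT ω).jbar_mem k
  have e := (hX.flow ω k _ h.1 h.2).2.1
  have e' := (inv_smul_eq_iff₀ (hpos (k + 1) (by omega)).ne').1 e
  exact (sub_eq_iff_eq_add'.1 e')

theorem flowEnd_snd (hX : IsSimulatorSolution Ψi κ T hs hf y X) (hT : 0 < T)
    (hpos : ∀ k, 1 ≤ k → 0 < hf k) (ω : Ω) (k : ℕ) :
    ((X ω).flowEnd k).2 = ((X ω).flowStart k).2 + hf (k + 1) •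
      (∇ (Ψi (y (k + 1) ω)) ((X ω).flowStart k).1.1 - ((X ω).flowStart k).2) := by
  have h := (hX.isCompleteK hT ω).jbar_mem k
  have e := (hX.flow ω k _ h.1 h.2).2.2
  have e' := (inv_smul_eq_iff₀ (hpos (k + 1) (by omega)).ne').1 e
  exact (sub_eq_iff_eq_add'.1 e')

theorem flowStart_succ (hX : IsSimulatorSolution Ψi κ T hs hf y X) (hT : 0 < T) (ω : Ω)
    (k : ℕ) : (X ω).flowStart (k + 1) = (X ω).flowEnd k ∨
      ((X ω).flowEnd k ∈ simD T ∧
        ((X ω).flowStart (k + 1)).1 = jumpHB ((X ω).flowEnd k).1 ∧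
        ((X ω).flowStart (k + 1)).2 = ((X ω).flowEnd k).2) := by
  have hK := hX.isCompleteK hT ω
  have h1 := hK.jbar_mem k
  have h2 := hK.jbar_mem (k + 1)
  rcases (hX.noDoubleJump hT ω).jbar_cases hK h1.2 with h | h
  · left
    rw [HybridSeq.flowStart, h, HybridSeq.flowEnd]
  · right
    rw [h] at h2
    rw [HybridSeq.flowStart, h, HybridSeq.flowEnd]
    exact hX.jump ω _ _ h1.2 h2.1

/-- Jumps change neither `q` nor `ξ`, so these are functions of `k` alone. -/
theorem position_eq (hX : IsSimulatorSolution Ψi κ T hs hf y X) (hT : 0 < T) (ω : Ω)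
    {k j : ℕ} (hz : (k, j) ∈ (X ω).dom) :
    ((X ω).val k j).1.1 = ((X ω).flowStart k).1.1 := by
  have hK := hX.isCompleteK hT ω
  rw [HybridSeq.flowStart]
  rcases (hX.noDoubleJump hT ω).jbar_cases hK hz with h | h
  · rw [h]
  · have h1 := (hK.jbar_mem k).1
    rw [h] at h1 ⊢
    rw [(hX.jump ω _ _ hz h1).2.1, jumpHB]

theorem fast_eq (hX : IsSimulatorSolution Ψi κ T hs hf y X) (hT : 0 < T) (ω : Ω)
    {k j : ℕ} (hz : (k, j) ∈ (X ω).dom) :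
    ((X ω).val k j).2 = ((X ω).flowStart k).2 := by
  have hK := hX.isCompleteK hT ω
  rw [HybridSeq.flowStart]
  rcases (hX.noDoubleJump hT ω).jbar_cases hK hz with h | h
  · rw [h]
  · have h1 := (hK.jbar_mem k).1
    rw [h] at h1 ⊢
    rw [(hX.jump ω _ _ hz h1).2.2]

theorem position_succ (hX : IsSimulatorSolution Ψi κ T hs hf y X) (hT : 0 < T)
    (hpos : ∀ k, 1 ≤ k → 0 < hs k) (ω : Ω) (k : ℕ) :
    ((X ω).flowStart (k + 1)).1.1 =
      ((X ω).flowStart k).1.1 + hs (k + 1) • ((X ω).flowStart k).1.2.1 := by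
  have h := congrArg Prod.fst (hX.flowEnd_fst hT hpos ω k)
  have e : ((X ω).flowStart (k + 1)).1.1 = ((X ω).flowEnd k).1.1 := by
    rcases hX.flowStart_succ hT ω k with h | h
    · rw [h]
    · rw [h.2.1, jumpHB]
  rw [e, h]
  rfl

theorem fast_succ (hX : IsSimulatorSolution Ψi κ T hs hf y X) (hT : 0 < T)
    (hpos : ∀ k, 1 ≤ k → 0 < hf k) (ω : Ω) (k : ℕ) :
    ((X ω).flowStart (k + 1)).2 = ((X ω).flowStart k).2 + hf (k + 1) •
      (∇ (Ψi (y (k + 1) ω)) ((X ω).flowStart k).1.1 - ((X ω).flowStart k).2) := by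
  rw [← hX.flowEnd_snd hT hpos ω k]
  rcases hX.flowStart_succ hT ω k with h | h
  · rw [h]
  · exact h.2.2

theorem exists_bound (hX : IsSimulatorSolution Ψi κ T hs hf y X) (hT : 0 < T) {ω : Ω}
    (hb : (X ω).IsBounded) :
    ∃ R : ℝ, ∀ k, ‖(X ω).flowStart k‖ ≤ R ∧ ‖(X ω).flowEnd k‖ ≤ R := by
  obtain ⟨R, hR⟩ := Bornology.IsBounded.exists_norm_le hb
  refine ⟨R, fun k => ?_⟩
  have h := (hX.isCompleteK hT ω).jbar_mem k
  exact ⟨hR _ ⟨_, h.1, Nat.zero_le _, rfl⟩, hR _ ⟨_, h.2, Nat.zero_le _, rfl⟩⟩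

/-- Since `q` is constant on column `k`, the column meets the preimage of `U` exactly when this
value lies in `U`. No measurable selection of a row is required. -/
theorem measurable_position (hX : IsSimulatorSolution Ψi κ T hs hf y X) (hT : 0 < T)
    (k : ℕ) : Measurable[indexFiltration y k] fun ω => ((X ω).flowStart k).1.1 := by
  refine @measurable_of_isOpen _ _ _ _ _ (indexFiltration y k) _ fun U hU => ?_
  have hO : IsOpen {z : ℕ × ℕ × FullState n | z.2.2.1.1 ∈ U} :=
    hU.preimage (by fun_prop)
  convert hX.adapted k _ hO using 1
  ext ω
  constructor
  · intro h
    exact ⟨(k, (X ω).jbar k, _), ⟨rfl, ((hX.isCompleteK hT ω).jbar_mem k).1, rfl⟩, h⟩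
  · rintro ⟨⟨k', j, x⟩, ⟨rfl, hz, hx⟩, hU⟩
    have h : x.1.1 ∈ U := hU
    rwa [show x = (X ω).val k' j from hx, hX.position_eq hT ω hz] at h

end IsSimulatorSolution

/-! ### Real sequences with negative drift -/

/-- Staying above `a` would bound the partial sums of `h`, so `u` falls below `a` at some late time.
Afterwards it cannot pass `b`: from below `a` one step reaches at most `b`, and from above `a` it
does not increase. -/
theorem eventually_le_of_drift {u h : ℕ → ℝ} {a b β : ℝ} (hpos : ∀ᶠ k in atTop, 0 ≤ h k)
    (hsum : ¬ Summable h) (hβ : 0 < β) (hab : a ≤ b)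
    (hdec : ∀ᶠ k in atTop, a ≤ u k → u (k + 1) ≤ u k - β * h k)
    (hstay : ∀ᶠ k in atTop, u k < a → u (k + 1) ≤ b) :
    ∀ᶠ k in atTop, u k ≤ b := by
  obtain ⟨K, hK⟩ := eventually_atTop.1 (hpos.and (hdec.and hstay))
  obtain ⟨k₀, hk₀, hlt⟩ : ∃ k ≥ K, u k < a := by
    by_contra! hge
    refine hsum ((summable_nat_add_iff K).1 ?_)
    refine summable_of_sum_range_le (c := (u K - a) / β) (fun k => (hK _ (by omega)).1)
      fun n => ?_
    have key : u (n + K) ≤ u K - β * ∑ i ∈ Finset.range n, h (i + K) := by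
      induction n with
      | zero => simp
      | succ n ih =>
        have := (hK (n + K) (by omega)).2.1 (hge _ (by omega))
        rw [Finset.sum_range_succ, show n + 1 + K = n + K + 1 by ring]
        linarith
    rw [le_div_iff₀ hβ]
    linarith [hge (n + K) (by omega)]
  filter_upwards [eventually_ge_atTop k₀] with k hk
  induction k, hk using Nat.le_induction with
  | base => linarith
  | succ k hk ih =>
    obtain ⟨h1, h2, h3⟩ := hK k (hk₀.trans hk)
    rcases lt_or_ge (u k) a with h | h
    · exact h3 h
    · nlinarith [h2 h]

/-- Above any level `a > 0` the contraction gains at least `c * a * h k`, twice the error once `ε k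
< c * a / 2`. Below `a` the level is not exceeded. -/
theorem tendsto_zero_of_contraction {r h ε : ℕ → ℝ} {c : ℝ} (hc : 0 < c) (hr : ∀ k, 0 ≤ r k)
    (hpos : ∀ᶠ k in atTop, 0 ≤ h k) (hlim : Tendsto h atTop (𝓝 0)) (hsum : ¬ Summable h)
    (hε : Tendsto ε atTop (𝓝 0))
    (hstep : ∀ᶠ k in atTop, r (k + 1) ≤ (1 - c * h k) * r k + h k * ε k) :
    Tendsto r atTop (𝓝 0) := by
  have key : ∀ a : ℝ, 0 < a → ∀ᶠ k in atTop, r k ≤ a := by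
    intro a ha
    have hca : 0 < c * a / 2 := by positivity
    have h1 : ∀ᶠ k in atTop, ε k < c * a / 2 := hε.eventually (gt_mem_nhds hca)
    have h2 : ∀ᶠ k in atTop, h k < 1 / c := hlim.eventually (gt_mem_nhds (by positivity))
    refine eventually_le_of_drift (a := a) hpos hsum hca le_rfl ?_ ?_
    · filter_upwards [hpos, hstep, h1] with k hk hs he ha'
      have e1 : h k * ε k ≤ h k * (c * a / 2) := mul_le_mul_of_nonneg_left he.le hk
      have e2 : c * h k * a ≤ c * h k * r k := mul_le_mul_of_nonneg_left ha' (by positivity)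
      linarith
    · filter_upwards [hpos, hstep, h1, h2] with k hk hs he hh ha'
      have e1 : h k * ε k ≤ h k * (c * a / 2) := mul_le_mul_of_nonneg_left he.le hk
      have e3 : c * h k ≤ 1 := by
        rw [lt_div_iff₀ hc] at hh
        linarith
      have e2 : (1 - c * h k) * r k ≤ (1 - c * h k) * a :=
        mul_le_mul_of_nonneg_left ha'.le (by linarith)
      have e4 : 0 ≤ c * h k * a := by positivity
      linarith
  refine Metric.tendsto_atTop.2 fun δ hδ => ?_
  obtain ⟨K, hK⟩ := eventually_atTop.1 (key (δ / 2) (by positivity))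
  refine ⟨K, fun k hk => ?_⟩
  rw [Real.dist_eq, sub_zero, abs_of_nonneg (hr k)]
  linarith [hK k hk]

/-! ### Exponential averages of bounded noise -/

/-- Second-order Taylor remainder with a crude constant. Raising the exponent multiplies the
remainder by `a + b` and adds `(n + 2) b² a ^ (n + 1)`; the constants close up because `(n + 2)² +
(n + 2) ≤ (n + 3)²`. -/
theorem abs_add_pow_sub_le (a b : ℝ) (n : ℕ) :
    |(a + b) ^ (n + 2) - a ^ (n + 2) - (n + 2) * a ^ (n + 1) * b| ≤
      (n + 2) ^ 2 * b ^ 2 * (|a| + |b|) ^ n := by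
  induction n with
  | zero =>
    have : (a + b) ^ (0 + 2) - a ^ (0 + 2) - ((0 : ℕ) + 2) * a ^ (0 + 1) * b = b ^ 2 := by
      push_cast; ring
    rw [this, abs_of_nonneg (sq_nonneg b)]
    push_cast
    nlinarith [sq_nonneg b]
  | succ n ih =>
    have e : (a + b) ^ (n + 1 + 2) - a ^ (n + 1 + 2)
        - (((n + 1 : ℕ) : ℝ) + 2) * a ^ (n + 1 + 1) * b
        = (a + b) * ((a + b) ^ (n + 2) - a ^ (n + 2) - (n + 2) * a ^ (n + 1) * b)
          + (n + 2) * (b ^ 2 * a ^ (n + 1)) := by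
      push_cast; ring
    have hs : 0 ≤ |a| + |b| := by positivity
    have h1 : |a + b| ≤ |a| + |b| := abs_add_le a b
    have h2 : |a ^ (n + 1)| ≤ (|a| + |b|) ^ (n + 1) := by
      rw [abs_pow]
      exact pow_le_pow_left₀ (abs_nonneg a) (by linarith [abs_nonneg b]) _
    rw [e]
    calc _ ≤ |a + b| * |(a + b) ^ (n + 2) - a ^ (n + 2) - (n + 2) * a ^ (n + 1) * b|
            + (n + 2) * (b ^ 2 * |a ^ (n + 1)|) := by
          refine (abs_add_le _ _).trans (le_of_eq ?_)
          rw [abs_mul, abs_mul, abs_mul, abs_of_nonneg (sq_nonneg b),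
            abs_of_nonneg (by positivity : (0 : ℝ) ≤ n + 2)]
      _ ≤ (|a| + |b|) * ((n + 2) ^ 2 * b ^ 2 * (|a| + |b|) ^ n)
            + (n + 2) * (b ^ 2 * (|a| + |b|) ^ (n + 1)) := by
          gcongr
      _ = ((n + 2) ^ 2 + (n + 2)) * (b ^ 2 * (|a| + |b|) ^ (n + 1)) := by ring
      _ ≤ (((n + 1 : ℕ) : ℝ) + 2) ^ 2 * (b ^ 2 * (|a| + |b|) ^ (n + 1)) := by
          gcongr
          push_cast
          nlinarith [(Nat.cast_nonneg n : (0 : ℝ) ≤ n)]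
      _ = _ := by ring

/-- Taylor expansion around `(1 - h) * M`. The linear term is kept because its mean vanishes. The
quadratic remainder is paid for by half of the damping, up to an error of the order `h ^ (r + 2)`
that the step sizes can sum. -/
theorem even_pow_average_le (r : ℕ) {B : ℝ} (hB : 0 ≤ B) :
    ∃ C : ℝ, 0 ≤ C ∧ ∀ h M ξ : ℝ, 0 ≤ h → h ≤ 1 → |ξ| ≤ B →
      ((1 - h) * M + h * ξ) ^ (2 * r + 2) ≤ (1 - 1 / 2 * h) * M ^ (2 * r + 2)
        + (2 * r + 2) * ((1 - h) * M) ^ (2 * r + 1) * h * ξ + C * h ^ (r + 2) := by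
  set D : ℝ := (2 * r + 2) ^ 2 * B ^ 2 with hD
  set Λ : ℝ := D * 2 ^ (2 * r + 2) with hΛ
  have hD0 : 0 ≤ D := by positivity
  have hΛ0 : 0 ≤ Λ := by positivity
  refine ⟨B ^ (2 * r + 2) + D * Λ ^ r, by positivity, fun h M ξ h0 h1 hξ => ?_⟩
  have hM : 0 ≤ M ^ (2 * r + 2) := by
    rw [show 2 * r + 2 = 2 * (r + 1) by ring, pow_mul]; positivity
  have key := (le_abs_self _).trans (abs_add_pow_sub_le ((1 - h) * M) (h * ξ) (2 * r))
  push_cast at key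
  have hp : (1 - h) ^ (2 * r + 2) ≤ 1 - h := by
    calc (1 - h) ^ (2 * r + 2) ≤ (1 - h) ^ 1 :=
          pow_le_pow_of_le_one (by linarith) (by linarith) (by omega)
      _ = 1 - h := pow_one _
  have hp' : ((1 - h) * M) ^ (2 * r + 2) ≤ (1 - h) * M ^ (2 * r + 2) := by
    rw [mul_pow]; exact mul_le_mul_of_nonneg_right hp hM
  set x : ℝ := |M| + h * B with hx
  have hx0 : 0 ≤ x := by positivity
  have hab : |(1 - h) * M| + |h * ξ| ≤ x := by
    rw [abs_mul, abs_mul, abs_of_nonneg h0, abs_of_nonneg (by linarith : 0 ≤ 1 - h)]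
    have := mul_le_mul_of_nonneg_left hξ h0
    nlinarith [abs_nonneg M]
  have hxi : ξ ^ 2 ≤ B ^ 2 := sq_le_sq' (by linarith [abs_le.1 hξ]) (abs_le.1 hξ).2
  have hrem : (2 * (r : ℝ) + 2) ^ 2 * (h * ξ) ^ 2 * (|(1 - h) * M| + |h * ξ|) ^ (2 * r)
      ≤ D * h ^ 2 * x ^ (2 * r) := by
    have : (2 * (r : ℝ) + 2) ^ 2 * (h * ξ) ^ 2 ≤ D * h ^ 2 := by
      rw [hD, mul_pow]
      nlinarith [mul_le_mul_of_nonneg_left hxi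
        (by positivity : 0 ≤ (2 * (r : ℝ) + 2) ^ 2 * h ^ 2)]
    gcongr
  -- Young's inequality by cases: for `x² ≥ Λ h` the remainder is a small multiple of `h * x ^ (2r +
  -- 2)`, otherwise `x ^ (2r) ≤ (Λ h) ^ r`. The factor `2 ^ (2r + 2)` in `Λ` offsets the convexity
  -- constant `2 ^ (2r + 1)` below and leaves the coefficient `1/2`.
  have hyoung : D * h ^ 2 * x ^ (2 * r) ≤
      h * x ^ (2 * r + 2) / 2 ^ (2 * r + 2) + D * Λ ^ r * h ^ (r + 2) := by
    rcases le_total (Λ * h) (x ^ 2) with hc | hc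
    · have e1 : D * h ^ 2 * x ^ (2 * r) ≤ h * x ^ (2 * r + 2) / 2 ^ (2 * r + 2) := by
        rw [le_div_iff₀ (by positivity)]
        calc D * h ^ 2 * x ^ (2 * r) * 2 ^ (2 * r + 2) = h * x ^ (2 * r) * (Λ * h) := by
              rw [hΛ]; ring
          _ ≤ h * x ^ (2 * r) * x ^ 2 := by gcongr
          _ = h * x ^ (2 * r + 2) := by ring
      have e2 : 0 ≤ D * Λ ^ r * h ^ (r + 2) := by positivity
      linarith
    · have e1 : D * h ^ 2 * x ^ (2 * r) ≤ D * Λ ^ r * h ^ (r + 2) := by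
        calc D * h ^ 2 * x ^ (2 * r) = D * h ^ 2 * (x ^ 2) ^ r := by rw [pow_mul]
          _ ≤ D * h ^ 2 * (Λ * h) ^ r := by gcongr
          _ = D * Λ ^ r * h ^ (r + 2) := by rw [mul_pow]; ring
      have e2 : 0 ≤ h * x ^ (2 * r + 2) / 2 ^ (2 * r + 2) := by positivity
      linarith
  have hxpow : h * x ^ (2 * r + 2) / 2 ^ (2 * r + 2) ≤
      1 / 2 * h * M ^ (2 * r + 2) + B ^ (2 * r + 2) * h ^ (r + 2) := by
    have e1 : x ^ (2 * r + 2) ≤ 2 ^ (2 * r + 1) * (|M| ^ (2 * r + 2) + (h * B) ^ (2 * r + 2)) :=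
      add_pow_le (abs_nonneg M) (by positivity) (2 * r + 2)
    have e2 : |M| ^ (2 * r + 2) = M ^ (2 * r + 2) := by
      rw [show 2 * r + 2 = 2 * (r + 1) by ring, pow_mul, pow_mul, sq_abs]
    have e3 : h * h ^ (2 * r + 2) ≤ h ^ (r + 2) := by
      rw [← pow_succ']
      exact pow_le_pow_of_le_one h0 h1 (by omega)
    rw [e2] at e1
    rw [div_le_iff₀ (by positivity)]
    calc h * x ^ (2 * r + 2)
        ≤ h * (2 ^ (2 * r + 1) * (M ^ (2 * r + 2) + (h * B) ^ (2 * r + 2))) := by gcongr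
      _ = 2 ^ (2 * r + 1) * (h * M ^ (2 * r + 2))
          + 2 ^ (2 * r + 1) * B ^ (2 * r + 2) * (h * h ^ (2 * r + 2)) := by rw [mul_pow]; ring
      _ ≤ 2 ^ (2 * r + 1) * (h * M ^ (2 * r + 2))
          + 2 ^ (2 * r + 1) * B ^ (2 * r + 2) * h ^ (r + 2) := by gcongr
      _ ≤ 2 ^ (2 * r + 1) * (h * M ^ (2 * r + 2))
          + 2 * (2 ^ (2 * r + 1) * B ^ (2 * r + 2) * h ^ (r + 2)) := by
          have : 0 ≤ 2 ^ (2 * r + 1) * B ^ (2 * r + 2) * h ^ (r + 2) := by positivity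
          linarith
      _ = _ := by ring
  nlinarith [key, hrem, hyoung, hxpow, hp']

theorem tendsto_zero_of_pow_tendsto_zero {u : ℕ → ℝ} {n : ℕ} (hn : n ≠ 0)
    (h : Tendsto (fun k => u k ^ n) atTop (𝓝 0)) : Tendsto u atTop (𝓝 0) := by
  refine squeeze_zero_norm' (a := fun k => (|u k ^ n|) ^ ((n : ℝ)⁻¹)) ?_ ?_
  · refine Eventually.of_forall fun k => ?_
    rw [abs_pow, Real.pow_rpow_inv_natCast (abs_nonneg _) hn, Real.norm_eq_abs]
  · have h' := (h.abs).rpow_const (p := (n : ℝ)⁻¹) (Or.inr (by positivity))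
    rwa [abs_zero, Real.zero_rpow (by positivity)] at h'

/-- Exponential averages of bounded martingale differences vanish almost surely, provided some
power of the step sizes is summable. -/
theorem exponential_average_tendsto_zero {Ω : Type*} {m0 : MeasurableSpace Ω} (P : Measure Ω)
    [IsProbabilityMeasure P] (ℱ : Filtration ℕ m0) {h : ℕ → ℝ} (hpos : ∀ k, 0 < h k)
    (hle : ∀ k, h k ≤ 1) (hlim : Tendsto h atTop (𝓝 0)) (hsum : ¬ Summable h) {r : ℕ}
    (hr : Summable fun k => h k ^ (r + 2)) {B : ℝ} (hB : 0 ≤ B) {ξ M : ℕ → Ω → ℝ}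
    (hξm : ∀ k, Measurable[ℱ (k + 1)] (ξ k)) (hξB : ∀ k ω, |ξ k ω| ≤ B)
    (hξ0 : ∀ k (Z : Ω → ℝ), Measurable[ℱ k] Z → (∃ C, ∀ ω, |Z ω| ≤ C) →
      ∫ ω, Z ω * ξ k ω ∂P = 0)
    (hM0 : ∀ ω, M 0 ω = 0)
    (hM : ∀ k ω, M (k + 1) ω = (1 - h k) * M k ω + h k * ξ k ω) :
    ∀ᵐ ω ∂P, Tendsto (fun k => M k ω) atTop (𝓝 0) := by
  obtain ⟨C, hC, hstep⟩ := even_pow_average_le r hB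
  have hMm : ∀ k, Measurable[ℱ k] (M k) := by
    intro k
    induction k with
    | zero =>
      rw [funext hM0]
      exact @measurable_const _ _ _ (ℱ 0) _
    | succ k ih =>
      rw [funext (hM k)]
      have ih' := ih.mono (ℱ.mono (Nat.le_succ k)) le_rfl
      exact (ih'.const_mul _).add ((hξm k).const_mul _)
  have hMB : ∀ k ω, |M k ω| ≤ B := by
    intro k ω
    induction k with
    | zero => rw [hM0, abs_zero]; exact hB
    | succ k ih =>
      rw [hM]
      refine (abs_add_le _ _).trans ?_
      rw [abs_mul, abs_mul, abs_of_pos (hpos k), abs_of_nonneg (sub_nonneg.2 (hle k))]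
      nlinarith [mul_le_mul_of_nonneg_left ih (sub_nonneg.2 (hle k)),
        mul_le_mul_of_nonneg_left (hξB k ω) (hpos k).le]
  set V : ℕ → Ω → ℝ := fun k ω => M k ω ^ (2 * r + 2) with hV
  have hV0 : ∀ k ω, 0 ≤ V k ω := by
    intro k ω
    simp only [hV]
    rw [show 2 * r + 2 = 2 * (r + 1) by ring, pow_mul]
    positivity
  have hVB : ∀ k ω, V k ω ≤ B ^ (2 * r + 2) := by
    intro k ω
    rw [← abs_of_nonneg (hV0 k ω)]
    simp only [hV, abs_pow]
    exact pow_le_pow_left₀ (abs_nonneg _) (hMB k ω) _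
  have hVm : ∀ k, Measurable[ℱ k] (V k) := fun k => (hMm k).pow_const _
  have hVi : ∀ k, Integrable (V k) P := fun k =>
    Integrable.of_bound ((hVm k).mono (ℱ.le k) le_rfl).aestronglyMeasurable (B ^ (2 * r + 2))
      (Eventually.of_forall fun ω => by
        rw [Real.norm_eq_abs, abs_of_nonneg (hV0 k ω)]; exact hVB k ω)
  have hset : ∀ k (s : Set Ω), MeasurableSet[ℱ k] s →
      ∫ ω in s, V (k + 1) ω ∂P ≤
        (1 - 1 / 2 * h k) * ∫ ω in s, V k ω ∂P + C * h k ^ (r + 2) * P.real s := by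
    intro k s hs
    have hs' := ℱ.le k s hs
    -- The coefficient of the linear noise term, cut off to `s`. It is known at time `k`, so its
    -- product with `ξ k` has integral zero.
    set Z : Ω → ℝ := s.indicator fun ω => (2 * r + 2) * ((1 - h k) * M k ω) ^ (2 * r + 1) * h k
      with hZ
    have hZm : Measurable[ℱ k] Z := by
      refine Measurable.indicator ?_ hs
      exact ((((hMm k).const_mul _).pow_const _).const_mul _).mul_const _
    have hZb : ∃ c, ∀ ω, |Z ω| ≤ c := by
      refine ⟨(2 * r + 2) * B ^ (2 * r + 1), fun ω => ?_⟩
      by_cases hω : ω ∈ s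
      · rw [hZ, Set.indicator_of_mem hω, abs_mul, abs_mul, abs_pow, abs_mul,
          abs_of_pos (hpos k), abs_of_nonneg (sub_nonneg.2 (hle k)),
          abs_of_nonneg (by positivity : (0 : ℝ) ≤ 2 * r + 2)]
        have h1 : (1 - h k) * |M k ω| ≤ B := by
          nlinarith [hMB k ω, abs_nonneg (M k ω), hpos k, hle k]
        have h0 : 0 ≤ (1 - h k) * |M k ω| :=
          mul_nonneg (sub_nonneg.2 (hle k)) (abs_nonneg _)
        have h2 := pow_le_pow_left₀ h0 h1 (2 * r + 1)
        calc _ ≤ (2 * (r : ℝ) + 2) * B ^ (2 * r + 1) * 1 := by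
              refine mul_le_mul (by gcongr) (hle k) (hpos k).le (by positivity)
          _ = _ := mul_one _
      · rw [hZ, Set.indicator_of_notMem hω, abs_zero]; positivity
    have hz := hξ0 k Z hZm hZb
    have hZi : Integrable (fun ω => Z ω * ξ k ω) P := by
      obtain ⟨c, hc⟩ := hZb
      refine Integrable.of_bound ((hZm.mono (ℱ.le k) le_rfl).mul
        ((hξm k).mono (ℱ.le _) le_rfl)).aestronglyMeasurable (c * B)
        (Eventually.of_forall fun ω => ?_)
      rw [Real.norm_eq_abs, abs_mul]
      exact mul_le_mul (hc ω) (hξB k ω) (abs_nonneg _) ((abs_nonneg _).trans (hc ω))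
    have hzs : ∫ ω in s, Z ω * ξ k ω ∂P = 0 := by
      rw [← integral_indicator hs', ← hz]
      congr 1
      ext ω
      by_cases hω : ω ∈ s
      · rw [Set.indicator_of_mem hω]
      · rw [Set.indicator_of_notMem hω, hZ, Set.indicator_of_notMem hω, zero_mul]
    have hi1 : Integrable (fun ω => (1 - 1 / 2 * h k) * V k ω) (P.restrict s) :=
      ((hVi k).const_mul _).restrict
    calc ∫ ω in s, V (k + 1) ω ∂P
        ≤ ∫ ω in s, ((1 - 1 / 2 * h k) * V k ω + Z ω * ξ k ω + C * h k ^ (r + 2)) ∂P := by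
          refine setIntegral_mono_on (hVi _).integrableOn
            (((hi1.add hZi.restrict).add (integrable_const _)) ) hs' fun ω hω => ?_
          rw [hZ, Set.indicator_of_mem hω]
          simp only [hV, hM]
          exact hstep _ _ _ (hpos k).le (hle k) (hξB k ω)
      _ = _ := by
          rw [integral_add (f := fun ω => (1 - 1 / 2 * h k) * V k ω + Z ω * ξ k ω)
              (hi1.add hZi.restrict) (integrable_const _),
            integral_add hi1 hZi.restrict, hzs, integral_const_mul, setIntegral_const]
          rw [smul_eq_mul]
          ring
  -- The remaining error budget: adding `C * tail k` to `V k` turns the recursion into a true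
  -- supermartingale.
  set tail : ℕ → ℝ := fun k => ∑' i, h (i + k) ^ (r + 2) with htail
  have htail_succ : ∀ k, tail k = h k ^ (r + 2) + tail (k + 1) := by
    intro k
    have := ((summable_nat_add_iff k).2 hr).tsum_eq_zero_add
    simp only [htail]
    rw [this, zero_add]
    congr 1
    refine tsum_congr fun i => ?_
    rw [show i + 1 + k = i + (k + 1) by ring]
  have htail0 : ∀ k, 0 ≤ tail k := fun k => tsum_nonneg fun i => pow_nonneg (hpos _).le _
  have htail_le : ∀ k, tail k ≤ tail 0 := by
    intro k
    induction k with
    | zero => exact le_rfl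
    | succ k ih => linarith [htail_succ k, pow_nonneg (hpos k).le (r + 2)]
  have htail_lim : Tendsto tail atTop (𝓝 0) :=
    tendsto_sum_nat_add fun k => h k ^ (r + 2)
  have hsuper : Supermartingale (fun k ω => V k ω + C * tail k) ℱ P := by
    refine supermartingale_of_setIntegral_succ_le (fun k => ?_)
      (fun k => (hVi k).add (integrable_const _)) fun k s hs => ?_
    · exact ((hVm k).add_const _).stronglyMeasurable
    · rw [integral_add (hVi _).restrict (integrable_const _),
        integral_add (hVi _).restrict (integrable_const _), setIntegral_const,
        setIntegral_const, smul_eq_mul, smul_eq_mul, htail_succ k]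
      have h1 := hset k s hs
      have h2 : 0 ≤ h k * ∫ ω in s, V k ω ∂P :=
        mul_nonneg (hpos k).le (integral_nonneg (hV0 k))
      nlinarith
  have hconv : ∀ᵐ ω ∂P, ∃ c, Tendsto (fun k => V k ω) atTop (𝓝 c) := by
    have hb : ∀ k, eLpNorm ((-fun k ω => V k ω + C * tail k) k) 1 P ≤
        ((B ^ (2 * r + 2) + C * tail 0).toNNReal : ℝ≥0∞) := by
      intro k
      refine (eLpNorm_le_of_ae_bound (C := B ^ (2 * r + 2) + C * tail 0)
        (Eventually.of_forall fun ω => ?_)).trans ?_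
      · have h1 := hV0 k ω
        have h2 := hVB k ω
        have h3 := mul_nonneg hC (htail0 k)
        have h4 := mul_le_mul_of_nonneg_left (htail_le k) hC
        simp only [Pi.neg_apply, norm_neg, Real.norm_eq_abs]
        rw [abs_of_nonneg (by linarith)]
        linarith
      · simp [ENNReal.ofReal]
    filter_upwards [hsuper.neg.exists_ae_tendsto_of_bdd hb] with ω ⟨c, hc⟩
    refine ⟨-c - C * 0, ?_⟩
    refine (hc.neg.sub (htail_lim.const_mul C)).congr fun k => ?_
    simp
  -- Almost sure convergence does not identify the limit; the damping gives convergence of the means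
  -- to zero, and Fatou's lemma carries this over to the limit.
  have hE : Tendsto (fun k => ∫ ω, V k ω ∂P) atTop (𝓝 0) := by
    refine tendsto_zero_of_contraction (c := 1 / 2) (h := h) (ε := fun k => C * h k ^ (r + 1))
      (by norm_num) (fun k => integral_nonneg (hV0 k))
      (Eventually.of_forall fun k => (hpos k).le) hlim hsum ?_ ?_
    · have := (hlim.pow (r + 1)).const_mul C
      simpa using this
    · refine Eventually.of_forall fun k => ?_
      have := hset k Set.univ MeasurableSet.univ
      rw [setIntegral_univ, setIntegral_univ, probReal_univ] at this
      refine this.trans (le_of_eq ?_)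
      ring
  have hfatou : ∫⁻ ω, liminf (fun k => ENNReal.ofReal (V k ω)) atTop ∂P = 0 := by
    refine le_antisymm ?_ bot_le
    refine (lintegral_liminf_le fun k =>
      ((hVm k).mono (ℱ.le k) le_rfl).ennreal_ofReal).trans ?_
    have : Tendsto (fun k => ∫⁻ ω, ENNReal.ofReal (V k ω) ∂P) atTop (𝓝 0) := by
      have h1 := (ENNReal.continuous_ofReal.tendsto 0).comp hE
      rw [ENNReal.ofReal_zero] at h1
      refine h1.congr fun k => ?_
      exact ofReal_integral_eq_lintegral_ofReal (hVi k) (Eventually.of_forall (hV0 k))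
    exact this.liminf_eq.le
  rw [lintegral_eq_zero_iff (Measurable.liminf fun k =>
      ((hVm k).mono (ℱ.le k) le_rfl).ennreal_ofReal)] at hfatou
  filter_upwards [hconv, hfatou] with ω ⟨c, hc⟩ h0
  have h1 := ((ENNReal.continuous_ofReal.tendsto c).comp hc).liminf_eq
  have h2 : ENNReal.ofReal c = 0 := by
    rw [← h1]; exact h0
  have h3 : c = 0 := le_antisymm (ENNReal.ofReal_eq_zero.1 h2)
    (ge_of_tendsto' hc fun k => hV0 k ω)
  rw [h3] at hc
  exact tendsto_zero_of_pow_tendsto_zero (n := 2 * r + 2) (by omega) hc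

/-! ### The gradient noise -/

theorem ContDiff.continuous_gradient {E : Type*} [NormedAddCommGroup E] [InnerProductSpace ℝ E]
    [CompleteSpace E] {f : E → ℝ} (hf : ContDiff ℝ 1 f) : Continuous (∇ f) :=
  (InnerProductSpace.toDual ℝ E).symm.continuous.comp (hf.continuous_fderiv one_ne_zero)

namespace ObjectiveAssumption

variable {n N : ℕ} {Ψ : EuclideanSpace ℝ (Fin n) → ℝ} {Ψi : Fin N → EuclideanSpace ℝ (Fin n) → ℝ}

theorem sum_gradient_sub (hΨ : ObjectiveAssumption Ψ Ψi) (q : EuclideanSpace ℝ (Fin n)) :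
    ∑ i, (∇ (Ψi i) q - ∇ Ψ q) = 0 := by
  have hN : (N : ℝ) ≠ 0 := by have := hΨ.one_le; positivity
  have h1 : HasGradientAt Ψ ((1 / (N : ℝ)) • ∑ i, ∇ (Ψi i) q) q := by
    rw [hasGradientAt_iff_hasFDerivAt, map_smul, map_sum, funext hΨ.eq_average]
    refine HasFDerivAt.const_mul (HasFDerivAt.fun_sum fun i _ => ?_) _
    exact (((hΨ.contDiff_summand i).differentiable one_ne_zero) q).hasGradientAt.hasFDerivAt
  rw [Finset.sum_sub_distrib, h1.gradient, Finset.sum_const, Finset.card_univ, Fintype.card_fin,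
    ← Nat.cast_smul_eq_nsmul ℝ, smul_smul, mul_one_div_cancel hN, one_smul, sub_self]

end ObjectiveAssumption

/-- The deviation of the gradient of a summand from the gradient of the average, cut off outside
the ball of radius `R`. -/
noncomputable def truncatedNoise {n N : ℕ} (Ψ : EuclideanSpace ℝ (Fin n) → ℝ)
    (Ψi : Fin N → EuclideanSpace ℝ (Fin n) → ℝ) (R : ℝ) (i : Fin N)
    (q : EuclideanSpace ℝ (Fin n)) : EuclideanSpace ℝ (Fin n) :=
  if ‖q‖ ≤ R then ∇ (Ψi i) q - ∇ Ψ q else 0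

namespace ObjectiveAssumption

variable {n N : ℕ} {Ψ : EuclideanSpace ℝ (Fin n) → ℝ} {Ψi : Fin N → EuclideanSpace ℝ (Fin n) → ℝ}

theorem measurable_truncatedNoise (hΨ : ObjectiveAssumption Ψ Ψi) (R : ℝ) (i : Fin N) :
    Measurable (truncatedNoise Ψ Ψi R i) :=
  Measurable.ite (measurableSet_le measurable_norm measurable_const)
    ((hΨ.contDiff_summand i).continuous_gradient.sub hΨ.contDiff.continuous_gradient).measurable
    measurable_const

/-- The cutoff depends on `q` and not on the index, so it preserves mean zero. -/
theorem sum_truncatedNoise (hΨ : ObjectiveAssumption Ψ Ψi) (R : ℝ)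
    (q : EuclideanSpace ℝ (Fin n)) : ∑ i, truncatedNoise Ψ Ψi R i q = 0 := by
  unfold truncatedNoise
  split_ifs
  · exact hΨ.sum_gradient_sub q
  · simp

theorem truncatedNoise_bound (hΨ : ObjectiveAssumption Ψ Ψi) (R : ℝ) :
    ∃ B, 0 ≤ B ∧ ∀ i q, ‖truncatedNoise Ψ Ψi R i q‖ ≤ B := by
  have h : ∀ i, ∃ B, ∀ q ∈ Metric.closedBall (0 : EuclideanSpace ℝ (Fin n)) R,
      ‖∇ (Ψi i) q - ∇ Ψ q‖ ≤ B := fun i =>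
    (isCompact_closedBall _ _).exists_bound_of_continuousOn
      ((hΨ.contDiff_summand i).continuous_gradient.sub
        hΨ.contDiff.continuous_gradient).continuousOn
  choose B hB using h
  have hle : ∀ i, |B i| ≤ ∑ i, |B i| := fun i =>
    Finset.single_le_sum (f := fun i => |B i|) (fun i _ => abs_nonneg _) (Finset.mem_univ i)
  refine ⟨∑ i, |B i|, Finset.sum_nonneg fun i _ => abs_nonneg _, fun i q => ?_⟩
  unfold truncatedNoise
  split_ifs with hq
  · exact (hB i q (by simpa using hq)).trans ((le_abs_self _).trans (hle i))
  · rw [norm_zero]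
    exact Finset.sum_nonneg fun i _ => abs_nonneg _

end ObjectiveAssumption

/-! ### Independence of the next index from the past -/

theorem indexFiltration_mono {Ω : Type*} {N : ℕ} {y : ℕ → Ω → Fin N} :
    Monotone (indexFiltration y) := by
  intro k l hkl
  refine iSup₂_le fun i hi => le_iSup₂_of_le i ?_ le_rfl
  rw [Finset.mem_Icc] at hi ⊢
  omega

theorem measurable_index {Ω : Type*} {N : ℕ} {y : ℕ → Ω → Fin N} (k : ℕ) :
    Measurable[indexFiltration y (k + 1)] (y (k + 1)) := by
  have h : MeasurableSpace.comap (y (k + 1)) inferInstance ≤ indexFiltration y (k + 1) :=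
    le_iSup₂_of_le (k + 1) (Finset.mem_Icc.2 ⟨by omega, le_rfl⟩) le_rfl
  exact measurable_iff_comap_le.2 h

namespace IsUniformIID

variable {Ω : Type*} [m0 : MeasurableSpace Ω] {P : Measure Ω} {N : ℕ} {y : ℕ → Ω → Fin N}

theorem indexFiltration_le (hy : IsUniformIID P y) (k : ℕ) : indexFiltration y k ≤ m0 :=
  iSup₂_le fun i hi => (hy.measurable i (Finset.mem_Icc.1 hi).1).comap_le

/-- The filtration generated by the indices, started at time `K`. -/
def shiftedFiltration (hy : IsUniformIID P y) (K : ℕ) : Filtration ℕ m0 where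
  seq k := indexFiltration y (k + K)
  mono' _ _ h := indexFiltration_mono (Nat.add_le_add_right h K)
  le' _ := hy.indexFiltration_le _

theorem indep_next (hy : IsUniformIID P y) (k : ℕ) :
    Indep (indexFiltration y k) (MeasurableSpace.comap (y (k + 1)) inferInstance) P := by
  -- The independent family is `i ↦ y (i + 1)`: the set `{i | i < k}` carries `y_1, …, y_k`, and
  -- `{k}` carries `y_{k+1}`.
  have h := indep_iSup_of_disjoint (fun i => (hy.measurable (i + 1) (by omega)).comap_le)
    hy.indep.iIndep (S := {i | i < k}) (T := {k}) (by simp)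
  refine indep_of_indep_of_le_left (indep_of_indep_of_le_right h ?_) ?_
  · exact le_iSup₂_of_le k rfl le_rfl
  · refine iSup₂_le fun i hi => ?_
    rw [Finset.mem_Icc] at hi
    obtain ⟨i, rfl⟩ := Nat.exists_eq_add_of_le' hi.1
    exact le_iSup₂_of_le (f := fun i (_ : i ∈ {i | i < k}) =>
      MeasurableSpace.comap (y (i + 1)) inferInstance) i (by simp; omega) le_rfl

/-- Splitting according to the value of the next index, each term factors by independence with the
same weight `1/N`, and the terms `a i` add up to zero. -/
theorem integral_mul_next [IsProbabilityMeasure P] (hy : IsUniformIID P y) (k : ℕ) {Z : Ω → ℝ}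
    (hZ : Measurable[indexFiltration y k] Z) (hZb : ∃ C, ∀ ω, |Z ω| ≤ C)
    {a : Fin N → Ω → ℝ} (ha : ∀ i, Measurable[indexFiltration y k] (a i))
    {B : ℝ} (haB : ∀ i ω, |a i ω| ≤ B) (hsum : ∀ ω, ∑ i, a i ω = 0) :
    ∫ ω, Z ω * a (y (k + 1) ω) ω ∂P = 0 := by
  obtain ⟨C, hC⟩ := hZb
  have hle := hy.indexFiltration_le k
  have hy' := hy.measurable (k + 1) (by omega)
  have hWm : ∀ i, Measurable[indexFiltration y k] fun ω => Z ω * a i ω := fun i =>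
    hZ.mul (ha i)
  have hWi : ∀ i, Integrable (fun ω => Z ω * a i ω) P := fun i =>
    Integrable.of_bound ((hWm i).mono hle le_rfl).aestronglyMeasurable (C * B)
      (Eventually.of_forall fun ω => by
        rw [Real.norm_eq_abs, abs_mul]
        exact mul_le_mul (hC ω) (haB i ω) (abs_nonneg _) ((abs_nonneg _).trans (hC ω)))
  set b : Fin N → Fin N → ℝ := fun i j => if j = i then 1 else 0 with hb
  have hbm : ∀ i, Measurable (b i) := fun i => measurable_of_finite _
  have hbint : ∀ i, ∫ ω, b i (y (k + 1) ω) ∂P = (N : ℝ)⁻¹ := by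
    intro i
    have e : (fun ω => b i (y (k + 1) ω)) = Set.indicator (y (k + 1) ⁻¹' {i}) 1 := by
      ext ω
      by_cases h : y (k + 1) ω = i
      · rw [Set.indicator_of_mem (show ω ∈ y (k + 1) ⁻¹' {i} from h)]
        exact if_pos h
      · rw [Set.indicator_of_notMem (show ω ∉ y (k + 1) ⁻¹' {i} from h)]
        exact if_neg h
    have hu : P (y (k + 1) ⁻¹' {i}) = (N : ℝ≥0∞)⁻¹ := hy.uniform (k + 1) (by omega) i
    rw [e, integral_indicator_one (hy' (measurableSet_singleton i)), Measure.real, hu]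
    simp
  have hprod : ∀ i, ∫ ω, (Z ω * a i ω) * b i (y (k + 1) ω) ∂P =
      (∫ ω, Z ω * a i ω ∂P) * (N : ℝ)⁻¹ := by
    intro i
    rw [← hbint i]
    refine IndepFun.integral_fun_mul_eq_mul_integral ?_
      ((hWm i).mono hle le_rfl).aestronglyMeasurable
      ((hbm i).comp hy').aestronglyMeasurable
    rw [IndepFun_iff_Indep]
    refine indep_of_indep_of_le_left (indep_of_indep_of_le_right (hy.indep_next k) ?_)
      (hWm i).comap_le
    rw [show (fun ω => b i (y (k + 1) ω)) = b i ∘ y (k + 1) from rfl,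
      ← MeasurableSpace.comap_comp]
    exact MeasurableSpace.comap_mono (hbm i).comap_le
  have hexp : ∀ ω, Z ω * a (y (k + 1) ω) ω = ∑ i, (Z ω * a i ω) * b i (y (k + 1) ω) := by
    intro ω
    simp [hb]
  have hint : ∀ i, Integrable (fun ω => (Z ω * a i ω) * b i (y (k + 1) ω)) P := fun i =>
    (hWi i).mul_bdd (c := 1) ((hbm i).comp hy').aestronglyMeasurable
      (Eventually.of_forall fun ω => by simp only [hb]; split_ifs <;> simp)
  rw [integral_congr_ae (Eventually.of_forall hexp), integral_finsetSum _ fun i _ => hint i]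
  simp_rw [hprod]
  rw [← Finset.sum_mul, ← integral_finsetSum _ fun i _ => hWi i]
  simp_rw [← Finset.mul_sum, hsum]
  simp

end IsUniformIID

/-- The exponential average `M_{k+1} = (1 - h_k) M_k + h_k ξ_k`, started at `0`. -/
def exponentialAverage {E : Type*} [AddCommGroup E] [Module ℝ E] (h : ℕ → ℝ) (ξ : ℕ → E) :
    ℕ → E
  | 0 => 0
  | k + 1 => (1 - h k) • exponentialAverage h ξ k + h k • ξ k

theorem exponentialAverage_apply {n : ℕ} (h : ℕ → ℝ) (ξ : ℕ → EuclideanSpace ℝ (Fin n)) (k : ℕ)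
    (l : Fin n) :
    exponentialAverage h ξ k l = exponentialAverage h (fun k => ξ k l) k := by
  induction k with
  | zero => rfl
  | succ k ih => simp [exponentialAverage, ih]

namespace SimulatorSteps

/-- The moment argument needs an integer exponent. For steps at most one, raising the exponent from
`1 + p` to `r + 2` keeps summability; the first `K` steps are discarded to get there. -/
theorem exists_summable_pow {hs hf : ℕ → ℝ} (h : SimulatorSteps hs hf) :
    ∃ r K : ℕ, (∀ k, hf (k + K + 1) ≤ 1) ∧ Summable fun k => hf (k + K + 1) ^ (r + 2) := by
  obtain ⟨p, hp, hsum⟩ := h.summable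
  have hlim := h.admissible.fast.tendsto_zero
  obtain ⟨K, hK⟩ := eventually_atTop.1 (hlim.eventually (ge_mem_nhds one_pos))
  obtain ⟨r, hr⟩ := exists_nat_ge p
  have hpos : ∀ k, 0 < hf (k + K + 1) := fun k => h.admissible.fast.pos _ (by omega)
  refine ⟨r, K, fun k => hK _ (by omega), ?_⟩
  refine Summable.of_nonneg_of_le (fun k => pow_nonneg (hpos k).le _) (fun k => ?_)
    ((summable_nat_add_iff K).2 hsum)
  rw [← Real.rpow_natCast]
  refine Real.rpow_le_rpow_of_exponent_ge (hpos k) (hK _ (by omega)) ?_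
  push_cast
  linarith

end SimulatorSteps

/-! ### Almost sure tracking of the gradient -/

namespace IsSimulatorSolution

variable {n N : ℕ} {Ω : Type*} [MeasurableSpace Ω] {P : Measure Ω} [IsProbabilityMeasure P]
  {Ψ : EuclideanSpace ℝ (Fin n) → ℝ} {Ψi : Fin N → EuclideanSpace ℝ (Fin n) → ℝ} {κ T : ℝ}
  {hs hf : ℕ → ℝ} {y : ℕ → Ω → Fin N} {X : Ω → HybridSeq (FullState n)}

theorem truncated_average_tendsto (hX : IsSimulatorSolution Ψi κ T hs hf y X) (hT : 0 < T)
    (hΨ : ObjectiveAssumption Ψ Ψi) (hsteps : SimulatorSteps hs hf) (hy : IsUniformIID P y)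
    {r K : ℕ} (hK : ∀ k, hf (k + K + 1) ≤ 1) (hr : Summable fun k => hf (k + K + 1) ^ (r + 2))
    (R : ℝ) :
    ∀ᵐ ω ∂P, Tendsto (exponentialAverage (fun k => hf (k + K + 1)) fun k =>
      truncatedNoise Ψ Ψi R (y (k + K + 1) ω) ((X ω).flowStart (k + K)).1.1) atTop (𝓝 0) := by
  obtain ⟨B, hB, hnB⟩ := hΨ.truncatedNoise_bound R
  have hcoord : ∀ i q (l : Fin n), |truncatedNoise Ψ Ψi R i q l| ≤ B := fun i q l =>
    (PiLp.norm_apply_le (truncatedNoise Ψ Ψi R i q) l).trans (hnB i q)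
  have hcm : ∀ i k (l : Fin n), Measurable[indexFiltration y k] fun ω =>
      truncatedNoise Ψ Ψi R i ((X ω).flowStart k).1.1 l := by
    intro i k l
    have h1 : Measurable fun q => truncatedNoise Ψ Ψi R i q l :=
      (EuclideanSpace.proj (𝕜 := ℝ) l).continuous.measurable.comp
        (hΨ.measurable_truncatedNoise R i)
    exact h1.comp (hX.measurable_position hT k)
  have key : ∀ l : Fin n, ∀ᵐ ω ∂P, Tendsto (fun k =>
      exponentialAverage (fun k => hf (k + K + 1)) (fun k =>
        truncatedNoise Ψ Ψi R (y (k + K + 1) ω) ((X ω).flowStart (k + K)).1.1 l) k)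
      atTop (𝓝 0) := by
    intro l
    refine exponential_average_tendsto_zero P (hy.shiftedFiltration K)
      (h := fun k => hf (k + K + 1)) (r := r) (B := B)
      (ξ := fun k ω => truncatedNoise Ψ Ψi R (y (k + K + 1) ω) ((X ω).flowStart (k + K)).1.1 l)
      (fun k => hsteps.admissible.fast.pos _ (by omega)) hK ?_ ?_ hr hB ?_
      (fun k ω => hcoord _ _ _) ?_ (fun ω => rfl) (fun k ω => ?_)
    · have := (tendsto_add_atTop_iff_nat (K + 1)).2 hsteps.admissible.fast.tendsto_zero
      exact this
    · exact fun h => hsteps.admissible.fast.not_summable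
        ((summable_nat_add_iff (f := fun k => hf (k + 1)) K).1 h)
    · intro k
      have h1 : Measurable[indexFiltration y (k + K + 1)] (y (k + K + 1)) :=
        measurable_index (k + K)
      have h2 : ∀ i, Measurable[indexFiltration y (k + K + 1)] fun ω =>
          truncatedNoise Ψ Ψi R i ((X ω).flowStart (k + K)).1.1 l := fun i =>
        (hcm i (k + K) l).mono (indexFiltration_mono (by omega)) le_rfl
      have h3 : Measurable[indexFiltration y (k + K + 1)] fun ω =>
          truncatedNoise Ψ Ψi R (y (k + K + 1) ω) ((X ω).flowStart (k + K)).1.1 l := by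
        have e : (fun ω => truncatedNoise Ψ Ψi R (y (k + K + 1) ω)
            ((X ω).flowStart (k + K)).1.1 l) = fun ω => ∑ i, Set.indicator
              (y (k + K + 1) ⁻¹' {i})
              (fun ω => truncatedNoise Ψ Ψi R i ((X ω).flowStart (k + K)).1.1 l) ω := by
          ext ω
          rw [Finset.sum_eq_single (y (k + K + 1) ω), Set.indicator_of_mem (by simp)]
          · intro i _ hi
            exact Set.indicator_of_notMem (fun h => hi h.symm) _
          · simp
        rw [e]
        exact Finset.measurable_fun_sum _ fun i _ =>
          (h2 i).indicator (h1 (measurableSet_singleton i))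
      have e : (hy.shiftedFiltration K) (k + 1) = indexFiltration y (k + K + 1) := by
        change indexFiltration y (k + 1 + K) = _
        rw [show k + 1 + K = k + K + 1 by ring]
      rw [e]
      exact h3
    · intro k Z hZ hZb
      exact hy.integral_mul_next (k + K) hZ hZb
        (a := fun i ω => truncatedNoise Ψ Ψi R i ((X ω).flowStart (k + K)).1.1 l)
        (fun i => hcm i _ l) (fun i ω => hcoord _ _ _) fun ω => by
          have := congrArg (fun v : EuclideanSpace ℝ (Fin n) => v l)
            (hΨ.sum_truncatedNoise R ((X ω).flowStart (k + K)).1.1)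
          simpa using this
    · simp [exponentialAverage]
  filter_upwards [ae_all_iff.2 key] with ω hω
  have h1 := tendsto_pi_nhds.2 hω
  have h2 := ((PiLp.continuous_toLp 2 fun _ : Fin n => ℝ).tendsto _).comp h1
  refine h2.congr fun k => ?_
  ext l
  exact (exponentialAverage_apply _ _ k l).symm

/-- On bounded sample paths the fast variable tracks the gradient of the objective. -/
theorem tracking (hX : IsSimulatorSolution Ψi κ T hs hf y X) (hT : 0 < T)
    (hΨ : ObjectiveAssumption Ψ Ψi) (hsteps : SimulatorSteps hs hf) (hy : IsUniformIID P y) :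
    ∀ᵐ ω ∂P, (X ω).IsBounded → Tendsto (fun k =>
      ((X ω).flowStart k).2 - ∇ Ψ ((X ω).flowStart k).1.1) atTop (𝓝 0) := by
  obtain ⟨r, K, hK, hr⟩ := hsteps.exists_summable_pow
  -- The bound on a path depends on `ω`. Countably many cutoff radii suffice, since on a bounded
  -- path a large enough one is never active.
  have hall := ae_all_iff.2 fun R : ℕ =>
    hX.truncated_average_tendsto hT hΨ hsteps hy hK hr (R : ℝ)
  filter_upwards [hall] with ω hω hb
  obtain ⟨R', hR'⟩ := hX.exists_bound hT hb
  obtain ⟨R, hR⟩ := exists_nat_ge R'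
  have hxR : ∀ k, ‖(X ω).flowStart k‖ ≤ R := fun k => (hR' k).1.trans hR
  have hM := hω R
  obtain ⟨L, hL⟩ := hΨ.lipschitz_gradient
  set x := (X ω).flowStart with hx
  set h : ℕ → ℝ := fun k => hf (k + K + 1) with hh
  have hpos : ∀ k, 0 < h k := fun k => hsteps.admissible.fast.pos _ (by omega)
  set M := exponentialAverage h fun k =>
    truncatedNoise Ψ Ψi R (y (k + K + 1) ω) (x (k + K)).1.1 with hMdef
  set e : ℕ → EuclideanSpace ℝ (Fin n) := fun k => (x (k + K)).2 - ∇ Ψ (x (k + K)).1.1 with he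
  have hnoise : ∀ k, truncatedNoise Ψ Ψi R (y (k + K + 1) ω) (x (k + K)).1.1 =
      ∇ (Ψi (y (k + K + 1) ω)) (x (k + K)).1.1 - ∇ Ψ (x (k + K)).1.1 := by
    intro k
    rw [truncatedNoise, if_pos]
    exact ((norm_fst_le _).trans (norm_fst_le _)).trans (hxR _)
  -- Subtracting `M` removes the noise and leaves a contraction perturbed only by the motion of `q`.
  have hrec : ∀ k, e (k + 1) - M (k + 1) = (1 - h k) • (e k - M k) +
      (∇ Ψ (x (k + K)).1.1 - ∇ Ψ (x (k + K + 1)).1.1) := by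
    intro k
    have h1 := hX.fast_succ hT hsteps.admissible.fast.pos ω (k + K)
    have h2 : M (k + 1) = (1 - h k) • M k + h k •
      truncatedNoise Ψ Ψi R (y (k + K + 1) ω) (x (k + K)).1.1 := rfl
    rw [h2, hnoise]
    simp only [he]
    rw [show k + 1 + K = k + K + 1 by ring, hx, h1]
    simp only [hh]
    module
  -- One step moves `q` by `hs` times a bounded momentum, hence `∇Ψ(q)` by `hf` times a multiple of
  -- `hs / hf`.
  have hincr : ∀ k, ‖∇ Ψ (x (k + K)).1.1 - ∇ Ψ (x (k + K + 1)).1.1‖ ≤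
      h k * (L * R * (hs (k + K + 1) / hf (k + K + 1))) := by
    intro k
    have hspos := hsteps.admissible.slow.pos (k + K + 1) (by omega)
    have h1 := hX.position_succ hT hsteps.admissible.slow.pos ω (k + K)
    have h2 := hL.dist_le_mul (x (k + K)).1.1 (x (k + K + 1)).1.1
    rw [dist_eq_norm, dist_eq_norm] at h2
    refine h2.trans ?_
    rw [hx, h1, sub_add_cancel_left, norm_neg, norm_smul, Real.norm_of_nonneg hspos.le]
    have h3 : ‖((X ω).flowStart (k + K)).1.2.1‖ ≤ R :=
      ((norm_fst_le _).trans ((norm_snd_le _).trans (norm_fst_le _))).trans (hxR _)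
    have h4 : h k * (L * R * (hs (k + K + 1) / hf (k + K + 1))) = L * (hs (k + K + 1) * R) := by
      have := (hpos k).ne'
      simp only [hh] at this ⊢
      field_simp
    rw [h4]
    gcongr
  have hlim : Tendsto h atTop (𝓝 0) :=
    (tendsto_add_atTop_iff_nat (K + 1)).2 hsteps.admissible.fast.tendsto_zero
  have hdiff : Tendsto (fun k => ‖e k - M k‖) atTop (𝓝 0) := by
    refine tendsto_zero_of_contraction (c := 1) (h := h)
      (ε := fun k => L * R * (hs (k + K + 1) / hf (k + K + 1))) one_pos
      (fun k => norm_nonneg _) (Eventually.of_forall fun k => (hpos k).le) hlim ?_ ?_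
      (Eventually.of_forall fun k => ?_)
    · exact fun h => hsteps.admissible.fast.not_summable
        ((summable_nat_add_iff (f := fun k => hf (k + 1)) K).1 h)
    · have h1 := ((tendsto_add_atTop_iff_nat (K + 1)).2 hsteps.admissible.separation).const_mul
        ((L : ℝ) * R)
      rw [mul_zero] at h1
      exact h1
    · rw [hrec]
      refine (norm_add_le _ _).trans (add_le_add (le_of_eq ?_) (hincr k))
      rw [norm_smul, one_mul, Real.norm_of_nonneg (sub_nonneg.2 (hK k))]
  have hfin := (tendsto_zero_iff_norm_tendsto_zero.2 hdiff).add hM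
  rw [add_zero] at hfin
  refine (tendsto_add_atTop_iff_nat K).1 (hfin.congr fun k => ?_)
  simp [he]

end IsSimulatorSolution

/-! ### A strict Lyapunov function for the heavy ball flow -/

section Lyapunov

variable {E : Type*} [NormedAddCommGroup E] [InnerProductSpace ℝ E] [CompleteSpace E]
  {Ψ : E → ℝ} {L : ℝ}

/-- Mean value inequality for `Ψ` minus its linearization at `x`, on the ball of radius `‖y - x‖`.
The constant `L` instead of `L/2` is enough here. -/
theorem descent_inequality (hd : Differentiable ℝ Ψ) (hL : 0 ≤ L)
    (hLip : ∀ x y, ‖∇ Ψ x - ∇ Ψ y‖ ≤ L * ‖x - y‖) (x y : E) :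
    Ψ y ≤ Ψ x + inner ℝ (∇ Ψ x) (y - x) + L * ‖y - x‖ ^ 2 := by
  have h := (convex_closedBall x ‖y - x‖).norm_image_sub_le_of_norm_hasFDerivWithin_le'
    (f := Ψ) (f' := fun z => InnerProductSpace.toDual ℝ E (∇ Ψ z))
    (φ := InnerProductSpace.toDual ℝ E (∇ Ψ x)) (C := L * ‖y - x‖) (x := x) (y := y)
    (fun z _ => (hd z).hasGradientAt.hasFDerivAt.hasFDerivWithinAt)
    (fun z hz => by
      rw [← map_sub, LinearIsometryEquiv.norm_map]
      refine (hLip z x).trans (mul_le_mul_of_nonneg_left ?_ hL)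
      rwa [mem_closedBall_iff_norm] at hz)
    (Metric.mem_closedBall_self (norm_nonneg _)) (mem_closedBall_iff_norm.2 le_rfl)
  have h2 := (le_abs_self _).trans h
  rw [InnerProductSpace.toDual_apply_apply] at h2
  linarith [h2, mul_assoc L ‖y - x‖ ‖y - x‖, sq ‖y - x‖, congrArg (L * ·) (sq ‖y - x‖)]

/-- A gradient step of length `1 / (2L)` cannot bring `Ψ` below `m`. -/
theorem norm_gradient_sq_le (hd : Differentiable ℝ Ψ) (hL : 0 < L)
    (hLip : ∀ x y, ‖∇ Ψ x - ∇ Ψ y‖ ≤ L * ‖x - y‖) {m : ℝ} (hm : ∀ x, m ≤ Ψ x) (x : E) :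
    ‖∇ Ψ x‖ ^ 2 ≤ 4 * L * (Ψ x - m) := by
  have h := descent_inequality hd hL.le hLip x (x - (1 / (2 * L)) • ∇ Ψ x)
  have h1 := hm (x - (1 / (2 * L)) • ∇ Ψ x)
  rw [sub_sub_cancel_left, inner_neg_right, norm_neg, inner_smul_right,
    real_inner_self_eq_norm_sq, norm_smul, Real.norm_of_nonneg (by positivity), mul_pow] at h
  have e : L * ((1 / (2 * L)) ^ 2 * ‖∇ Ψ x‖ ^ 2) = 1 / 4 * (‖∇ Ψ x‖ ^ 2 / L) := by
    field_simp
    ring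
  have e2 : 1 / (2 * L) * ‖∇ Ψ x‖ ^ 2 = 1 / 2 * (‖∇ Ψ x‖ ^ 2 / L) := by
    field_simp
  rw [e, e2] at h
  have h3 : ‖∇ Ψ x‖ ^ 2 / L ≤ 4 * (Ψ x - m) := by linarith
  rw [div_le_iff₀ hL] at h3
  linarith

/-- The total energy with a cross term. -/
noncomputable def crossEnergy (Ψ : E → ℝ) (c : ℝ) (q p : E) : ℝ :=
  Ψ q + ‖p‖ ^ 2 / 2 + c * inner ℝ (∇ Ψ q) p

/-- Friction alone dissipates only `κ|p|²`. The cross term contributes `-c|∇Ψ|²`, at the cost of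
`cL|p|²` from the change of the gradient and of `-cκ⟨∇Ψ, p⟩`, which Young's inequality splits. The
bound on `c` lets half of the friction absorb the `|p|²` terms. -/
theorem crossEnergy_flow_le (hd : Differentiable ℝ Ψ) (hL : 0 ≤ L)
    (hLip : ∀ x y, ‖∇ Ψ x - ∇ Ψ y‖ ≤ L * ‖x - y‖) {κ c : ℝ} (hc : 0 ≤ c)
    (hcκ : c * (L + κ ^ 2 / 2) ≤ κ / 2) {R S h : ℝ} (hh : 0 ≤ h) {q p ξ : E}
    (hp : ‖p‖ ≤ R) (hg : ‖∇ Ψ q‖ ≤ R) (hS : ‖κ • p + ξ‖ ≤ S) :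
    crossEnergy Ψ c (q + h • p) (p + h • (-(κ • p) - ξ)) ≤ crossEnergy Ψ c q p
      - h * (κ / 2 * ‖p‖ ^ 2 + c / 2 * ‖∇ Ψ q‖ ^ 2)
      + h * ((1 + c) * R * ‖ξ - ∇ Ψ q‖ + h * (L * R ^ 2 + S ^ 2 / 2 + c * (L * R * S))) := by
  have hR : 0 ≤ R := (norm_nonneg _).trans hp
  have hS0 : 0 ≤ S := (norm_nonneg _).trans hS
  set g := ∇ Ψ q with hgdef
  set v := κ • p + ξ with hv
  set e := ξ - g with he
  have hvneg : -(κ • p) - ξ = -v := by rw [hv]; abel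
  have hξ : ξ = g + e := by rw [he]; abel
  have hpot := descent_inequality hd hL hLip q (q + h • p)
  rw [add_sub_cancel_left, inner_smul_right, norm_smul, Real.norm_of_nonneg hh, mul_pow] at hpot
  have hkin : ‖p + h • -v‖ ^ 2 = ‖p‖ ^ 2 - 2 * h * inner ℝ p v + h ^ 2 * ‖v‖ ^ 2 := by
    rw [norm_add_sq_real, inner_smul_right, inner_neg_right, norm_smul, norm_neg,
      Real.norm_of_nonneg hh]
    ring
  have hpv : inner ℝ p v = κ * ‖p‖ ^ 2 + inner ℝ g p + inner ℝ p e := by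
    rw [hv, hξ, inner_add_right, inner_add_right, inner_smul_right, real_inner_self_eq_norm_sq,
      real_inner_comm]
    ring
  have hgv : inner ℝ g v = κ * inner ℝ g p + ‖g‖ ^ 2 + inner ℝ g e := by
    rw [hv, hξ, inner_add_right, inner_add_right, inner_smul_right, real_inner_self_eq_norm_sq]
    ring
  have hcross : inner ℝ (∇ Ψ (q + h • p)) (p + h • -v) ≤
      inner ℝ g p - h * inner ℝ g v + h * (L * ‖p‖ ^ 2) + h ^ 2 * (L * R * S) := by
    have e1 : inner ℝ (∇ Ψ (q + h • p)) (p + h • -v) =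
        inner ℝ g p - h * inner ℝ g v + inner ℝ (∇ Ψ (q + h • p) - g) (p + h • -v) := by
      have e0 : inner ℝ g (p + h • -v) = inner ℝ g p - h * inner ℝ g v := by
        rw [inner_add_right g p (h • -v), inner_smul_right, inner_neg_right]
        ring
      rw [inner_sub_left, e0]
      ring
    have e2 : inner ℝ (∇ Ψ (q + h • p) - g) (p + h • -v) ≤
        (L * (h * ‖p‖)) * (‖p‖ + h * ‖v‖) := by
      refine (real_inner_le_norm _ _).trans (mul_le_mul ?_ ?_ (norm_nonneg _) (by positivity))
      · refine (hLip _ _).trans (le_of_eq ?_)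
        rw [add_sub_cancel_left, norm_smul, Real.norm_of_nonneg hh]
      · refine (norm_add_le _ _).trans (le_of_eq ?_)
        rw [norm_smul, norm_neg, Real.norm_of_nonneg hh]
    have e3 : ‖p‖ * ‖v‖ ≤ R * S := mul_le_mul hp hS (norm_nonneg _) hR
    have e4 := mul_le_mul_of_nonneg_left e3 (by positivity : 0 ≤ h ^ 2 * L)
    rw [e1]
    nlinarith
  have hpe : -inner ℝ p e ≤ R * ‖e‖ := by
    have := neg_le_of_abs_le (abs_real_inner_le_norm p e)
    nlinarith [mul_le_mul_of_nonneg_right hp (norm_nonneg e)]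
  have hge : -inner ℝ g e ≤ R * ‖e‖ := by
    have := neg_le_of_abs_le (abs_real_inner_le_norm g e)
    nlinarith [mul_le_mul_of_nonneg_right hg (norm_nonneg e)]
  have hgp : -(κ * inner ℝ g p) ≤ ‖g‖ ^ 2 / 2 + κ ^ 2 * ‖p‖ ^ 2 / 2 := by
    have := sq_nonneg ‖g + κ • p‖
    rw [norm_add_sq_real, inner_smul_right, norm_smul, mul_pow, Real.norm_eq_abs, sq_abs] at this
    linarith
  have hp2 : ‖p‖ ^ 2 ≤ R ^ 2 := pow_le_pow_left₀ (norm_nonneg _) hp 2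
  have hv2 : ‖v‖ ^ 2 ≤ S ^ 2 := pow_le_pow_left₀ (norm_nonneg _) hS 2
  have hrate : -inner ℝ p v + inner ℝ g p - c * inner ℝ g v + c * (L * ‖p‖ ^ 2) ≤
      -(κ / 2 * ‖p‖ ^ 2 + c / 2 * ‖g‖ ^ 2) + (1 + c) * R * ‖e‖ := by
    rw [hpv, hgv]
    have h1 := mul_le_mul_of_nonneg_left hgp hc
    have h2 := mul_le_mul_of_nonneg_left hge hc
    have h3 := mul_le_mul_of_nonneg_right hcκ (sq_nonneg ‖p‖)
    nlinarith
  have hsecond : L * ‖p‖ ^ 2 + ‖v‖ ^ 2 / 2 ≤ L * R ^ 2 + S ^ 2 / 2 := by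
    linarith [mul_le_mul_of_nonneg_left hp2 hL]
  have k1 := mul_le_mul_of_nonneg_left hrate hh
  have k2 := mul_le_mul_of_nonneg_left hsecond (sq_nonneg h)
  have k3 := mul_le_mul_of_nonneg_left hcross hc
  rw [hvneg]
  unfold crossEnergy
  rw [hkin]
  nlinarith

/-- The jump condition gives `⟨∇Ψ, p⟩ ≥ -‖ξ - ∇Ψ‖ ‖p‖`; the lost kinetic energy compensates for this
after completing the square. -/
theorem crossEnergy_jump_le {c : ℝ} (hc : 0 ≤ c) {q p ξ : E} (h : 0 ≤ inner ℝ ξ p) :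
    crossEnergy Ψ c q 0 ≤ crossEnergy Ψ c q p + c ^ 2 * ‖ξ - ∇ Ψ q‖ ^ 2 / 2 := by
  unfold crossEnergy
  rw [inner_zero_right, norm_zero]
  have h1 := real_inner_le_norm (ξ - ∇ Ψ q) p
  rw [inner_sub_left] at h1
  have h2 := mul_le_mul_of_nonneg_left (by linarith :
    -(‖ξ - ∇ Ψ q‖ * ‖p‖) ≤ inner ℝ (∇ Ψ q) p) hc
  nlinarith [sq_nonneg (‖p‖ - c * ‖ξ - ∇ Ψ q‖)]

/-- By Young the cross term is at least `-‖p‖²/4 - c²‖∇Ψ‖²`, and `norm_gradient_sq_le` bounds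
`c²‖∇Ψ‖²` by `(Ψ q - m) / 2`. -/
theorem crossEnergy_lower_bound (hd : Differentiable ℝ Ψ) (hL : 0 < L)
    (hLip : ∀ x y, ‖∇ Ψ x - ∇ Ψ y‖ ≤ L * ‖x - y‖) {m : ℝ} (hm : ∀ x, m ≤ Ψ x) {c : ℝ}
    (hc : 0 ≤ c) (hcL : 8 * L * c ^ 2 ≤ 1) (q p : E) :
    ‖p‖ ^ 2 / 4 + (Ψ q - m) / 2 ≤ crossEnergy Ψ c q p - m := by
  unfold crossEnergy
  have h1 := neg_le_of_abs_le (abs_real_inner_le_norm (∇ Ψ q) p)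
  have h2 := mul_le_mul_of_nonneg_left h1 hc
  have h3 := mul_le_mul_of_nonneg_left (norm_gradient_sq_le hd hL hLip hm q) (sq_nonneg c)
  have h4 := mul_le_mul_of_nonneg_right hcL (sub_nonneg.2 (hm q))
  nlinarith [sq_nonneg (‖p‖ / 2 - c * ‖∇ Ψ q‖)]

theorem continuous_crossEnergy (hΨ : Continuous Ψ) (hg : Continuous (∇ Ψ)) (c : ℝ) :
    Continuous fun z : E × E => crossEnergy Ψ c z.1 z.2 := by
  unfold crossEnergy
  have h1 : Continuous fun z : E × E => ∇ Ψ z.1 := hg.comp continuous_fst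
  fun_prop

end Lyapunov

/-! ### Convergence of perturbed heavy ball iterations -/

/-- Bounded iterates of the heavy ball system with resets, whose gradient estimates are
asymptotically exact: `x k` is the state before, and `w k` the state after the `k`-th flow step. -/
structure IsHeavyBallIteration {n : ℕ} (Ψ : EuclideanSpace ℝ (Fin n) → ℝ) (κ T : ℝ)
    (h : ℕ → ℝ) (x w : ℕ → FullState n) : Prop where
  step_pos : ∀ k, 0 < h k
  step_lim : Tendsto h atTop (𝓝 0)
  step_sum : ¬ Summable h
  flow : ∀ k, (w k).1 = (x k).1 + h k • flowHB κ T (x k).1 (x k).2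
  next : ∀ k, x (k + 1) = w k ∨
    (w k ∈ simD T ∧ (x (k + 1)).1 = jumpHB (w k).1 ∧ (x (k + 1)).2 = (w k).2)
  bounded : ∃ R : ℝ, ∀ k, ‖x k‖ ≤ R ∧ ‖w k‖ ≤ R
  tracking : Tendsto (fun k => (x k).2 - ∇ Ψ (x k).1.1) atTop (𝓝 0)

namespace IsHeavyBallIteration

variable {n N : ℕ} {Ψ : EuclideanSpace ℝ (Fin n) → ℝ} {κ T : ℝ} {h : ℕ → ℝ}
  {x w : ℕ → FullState n}

theorem components_le {z : FullState n} {R : ℝ} (hz : ‖z‖ ≤ R) :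
    ‖z.1.1‖ ≤ R ∧ ‖z.1.2.1‖ ≤ R ∧ |z.1.2.2| ≤ R ∧ ‖z.2‖ ≤ R := by
  have h1 := (norm_fst_le z).trans hz
  have h2 := (norm_snd_le z.1).trans h1
  exact ⟨(norm_fst_le z.1).trans h1, (norm_fst_le z.1.2).trans h2, (norm_snd_le z.1.2).trans h2,
    (norm_snd_le z).trans hz⟩

theorem flow_position (hI : IsHeavyBallIteration Ψ κ T h x w) (k : ℕ) :
    (w k).1.1 = (x k).1.1 + h k • (x k).1.2.1 := by
  rw [hI.flow]; rfl

theorem flow_momentum (hI : IsHeavyBallIteration Ψ κ T h x w) (k : ℕ) :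
    (w k).1.2.1 = (x k).1.2.1 + h k • (-(κ • (x k).1.2.1) - (x k).2) := by
  rw [hI.flow]; rfl

theorem flow_timer (hI : IsHeavyBallIteration Ψ κ T h x w) (k : ℕ) :
    (w k).1.2.2 = (x k).1.2.2 + h k * min 1 (2 - (x k).1.2.2 / T) := by
  rw [hI.flow]; rfl

theorem next_position (hI : IsHeavyBallIteration Ψ κ T h x w) (k : ℕ) :
    (x (k + 1)).1.1 = (w k).1.1 := by
  rcases hI.next k with h | h
  · rw [h]
  · rw [h.2.1, jumpHB]

theorem next_fast (hI : IsHeavyBallIteration Ψ κ T h x w) (k : ℕ) : (x (k + 1)).2 = (w k).2 := by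
  rcases hI.next k with h | h
  · rw [h]
  · exact h.2.2

theorem next_timer (hI : IsHeavyBallIteration Ψ κ T h x w) (k : ℕ) :
    (x (k + 1)).1.2.2 = (w k).1.2.2 ∨ ((x (k + 1)).1.2.2 = 0 ∧ T ≤ (w k).1.2.2) := by
  rcases hI.next k with h | h
  · rw [h]; exact Or.inl rfl
  · rw [h.2.1]; exact Or.inr ⟨rfl, h.1.2⟩

/-- The term `bτ` grows by at most `b h` per flow step and drops by at least `bT` at a jump. However
small `b` is, this drop eventually exceeds the vanishing gain of the cross energy. -/
theorem energy_step (hI : IsHeavyBallIteration Ψ κ T h x w) (hT : 0 < T)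
    (hd : Differentiable ℝ Ψ) {L : ℝ} (hL : 0 ≤ L)
    (hLip : ∀ x y, ‖∇ Ψ x - ∇ Ψ y‖ ≤ L * ‖x - y‖) {c : ℝ} (hc : 0 ≤ c)
    (hcκ : c * (L + κ ^ 2 / 2) ≤ κ / 2) (hg : Continuous (∇ Ψ)) :
    ∃ ε : ℕ → ℝ, Tendsto ε atTop (𝓝 0) ∧ ∀ b : ℝ, 0 < b → ∀ᶠ k in atTop,
      crossEnergy Ψ c (x (k + 1)).1.1 (x (k + 1)).1.2.1 + b * (x (k + 1)).1.2.2 ≤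
        crossEnergy Ψ c (x k).1.1 (x k).1.2.1 + b * (x k).1.2.2
        - h k * (κ / 2 * ‖(x k).1.2.1‖ ^ 2 + c / 2 * ‖∇ Ψ (x k).1.1‖ ^ 2)
        + h k * (ε k + b) := by
  obtain ⟨R₀, hR₀⟩ := hI.bounded
  obtain ⟨G, hG⟩ := (isCompact_closedBall (0 : EuclideanSpace ℝ (Fin n)) R₀)
    |>.exists_bound_of_continuousOn hg.continuousOn
  set R := max R₀ G with hR
  set S := |κ| * R₀ + R₀ with hS
  set D := L * R ^ 2 + S ^ 2 / 2 + c * (L * R * S) with hD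
  have herr : Tendsto (fun k => ‖(x k).2 - ∇ Ψ (x k).1.1‖) atTop (𝓝 0) :=
    tendsto_zero_iff_norm_tendsto_zero.1 hI.tracking
  refine ⟨fun k => (1 + c) * R * ‖(x k).2 - ∇ Ψ (x k).1.1‖ + h k * D, ?_, fun b hb => ?_⟩
  · have := (herr.const_mul ((1 + c) * R)).add (hI.step_lim.mul_const D)
    simpa using this
  have hjump : ∀ᶠ k in atTop,
      c ^ 2 * ‖(x (k + 1)).2 - ∇ Ψ (x (k + 1)).1.1‖ ^ 2 / 2 ≤ b * T := by
    have h1 := ((((tendsto_add_atTop_iff_nat 1).2 herr).pow 2).const_mul (c ^ 2)).div_const 2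
    have h2 : c ^ 2 * 0 ^ 2 / 2 < b * T := by
      have := mul_pos hb hT
      simpa using this
    exact (h1.eventually (gt_mem_nhds h2)).mono fun k hk => le_of_lt hk
  filter_upwards [hjump] with k hk
  obtain ⟨hq, hp, -, hξ⟩ := components_le (hR₀ k).1
  have hflow := crossEnergy_flow_le (S := S) hd hL hLip hc hcκ (hI.step_pos k).le
    (hp.trans (le_max_left R₀ G))
    ((hG (x k).1.1 (mem_closedBall_zero_iff.2 hq)).trans (le_max_right R₀ G))
    (by
      refine (norm_add_le (κ • (x k).1.2.1) (x k).2).trans (add_le_add ?_ hξ)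
      rw [norm_smul, Real.norm_eq_abs]
      exact mul_le_mul_of_nonneg_left hp (abs_nonneg κ))
  rw [← hI.flow_position, ← hI.flow_momentum, ← hR, ← hD] at hflow
  have htimer : b * (w k).1.2.2 ≤ b * (x k).1.2.2 + h k * b := by
    rw [hI.flow_timer]
    have := mul_le_mul_of_nonneg_left (min_le_left 1 (2 - (x k).1.2.2 / T))
      (mul_pos hb (hI.step_pos k)).le
    linarith
  have hafter : crossEnergy Ψ c (x (k + 1)).1.1 (x (k + 1)).1.2.1 + b * (x (k + 1)).1.2.2 ≤
      crossEnergy Ψ c (w k).1.1 (w k).1.2.1 + b * (w k).1.2.2 := by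
    rcases hI.next k with e | ⟨⟨hin, hT'⟩, e, -⟩
    · rw [e]
    · have h1 := crossEnergy_jump_le (Ψ := Ψ) (q := (w k).1.1) hc hin
      -- A jump keeps `q` and `ξ`, so the error at `w k` is the tracking error at `x (k + 1)`.
      rw [← hI.next_position, ← hI.next_fast] at h1
      have h2 := mul_le_mul_of_nonneg_left hT' hb.le
      have e1 : (x (k + 1)).1.2.1 = 0 := by rw [e, jumpHB]
      have e2 : (x (k + 1)).1.2.2 = 0 := by rw [e, jumpHB]
      rw [e1, e2, ← hI.next_position]
      linarith
  linarith

theorem eventually_energy_le (hI : IsHeavyBallIteration Ψ κ T h x w) (hκ : 0 < κ) (hT : 0 < T)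
    (hdiff : ContDiff ℝ 1 Ψ) {L : ℝ} (hL : 0 ≤ L)
    (hLip : ∀ x y, ‖∇ Ψ x - ∇ Ψ y‖ ≤ L * ‖x - y‖) {m : ℝ}
    (hcrit : ∀ q, ∇ Ψ q = 0 → Ψ q = m) {c : ℝ} (hc : 0 < c)
    (hcκ : c * (L + κ ^ 2 / 2) ≤ κ / 2) {δ : ℝ} (hδ : 0 < δ) :
    ∀ᶠ k in atTop, crossEnergy Ψ c (x k).1.1 (x k).1.2.1 ≤ m + 4 * δ := by
  have hg := hdiff.continuous_gradient
  have hW := continuous_crossEnergy hdiff.continuous hg c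
  obtain ⟨R, hR⟩ := hI.bounded
  have hR0 : 0 ≤ R := (norm_nonneg _).trans (hR 0).1
  obtain ⟨ε, hε, hstep⟩ := hI.energy_step hT (hdiff.differentiable one_ne_zero) hL hLip hc.le
    hcκ hg
  set A : Set (EuclideanSpace ℝ (Fin n) × EuclideanSpace ℝ (Fin n)) :=
    Metric.closedBall 0 R ∩ {z | m + δ ≤ crossEnergy Ψ c z.1 z.2} with hA
  have hAc : IsCompact A :=
    (isCompact_closedBall 0 R).inter_right (isClosed_le continuous_const hW)
  have hcont : Continuous fun z : EuclideanSpace ℝ (Fin n) × EuclideanSpace ℝ (Fin n) =>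
      κ / 2 * ‖z.2‖ ^ 2 + c / 2 * ‖∇ Ψ z.1‖ ^ 2 := by
    have h1 : Continuous fun z : EuclideanSpace ℝ (Fin n) × EuclideanSpace ℝ (Fin n) =>
      ∇ Ψ z.1 := hg.comp continuous_fst
    fun_prop
  -- The dissipation vanishes only where `p = 0` and `∇Ψ = 0`; there the energy equals `m`, which
  -- excludes `A`. Compactness gives a positive lower bound.
  obtain ⟨μ, hμ, hμA⟩ := hAc.exists_forall_le' hcont.continuousOn (a := 0) (fun z hz => by
    by_contra hle
    have h1 : 0 ≤ κ / 2 * ‖z.2‖ ^ 2 := by positivity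
    have h2 : 0 ≤ c / 2 * ‖∇ Ψ z.1‖ ^ 2 := by positivity
    have h3 : κ / 2 * ‖z.2‖ ^ 2 = 0 := by linarith
    have h4 : c / 2 * ‖∇ Ψ z.1‖ ^ 2 = 0 := by linarith
    have hz2 : z.2 = 0 := by simpa [hκ.ne'] using h3
    have hz1 : ∇ Ψ z.1 = 0 := by simpa [hc.ne'] using h4
    have h5 := hz.2
    simp only [Set.mem_ofPred_eq, crossEnergy, hz2, hz1, hcrit _ hz1, norm_zero,
      inner_zero_left] at h5
    linarith)
  -- With `ε ≤ μ/4` the first bound leaves the drift `-μ/2`. The second keeps `|bτ| ≤ δ`, so the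
  -- timer term shifts levels by at most `δ`.
  set b := min (μ / 4) (δ / (R + 1)) with hb
  have hb0 : 0 < b := lt_min (by positivity) (by positivity)
  have hbR : b * R ≤ δ := by
    have h1 : b * R ≤ δ / (R + 1) * R := mul_le_mul_of_nonneg_right (min_le_right _ _) hR0
    have h2 : δ / (R + 1) * R ≤ δ := by
      rw [div_mul_eq_mul_div, div_le_iff₀ (by positivity)]
      nlinarith
    linarith
  have htb : ∀ k, |b * (x k).1.2.2| ≤ δ := by
    intro k
    rw [abs_mul, abs_of_pos hb0]
    exact (mul_le_mul_of_nonneg_left (components_le (hR k).1).2.2.1 hb0.le).trans hbR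
  have hev : ∀ᶠ k in atTop, crossEnergy Ψ c (x k).1.1 (x k).1.2.1 + b * (x k).1.2.2 ≤
      m + 3 * δ := by
    refine eventually_le_of_drift (a := m + 2 * δ) (β := μ / 2) (h := h)
      (Eventually.of_forall fun k => (hI.step_pos k).le) hI.step_sum (by positivity)
      (by linarith) ?_ ?_
    · filter_upwards [hstep b hb0, hε.eventually (gt_mem_nhds (by positivity : 0 < μ / 4))]
        with k hk hεk hge
      have h1 : m + δ ≤ crossEnergy Ψ c (x k).1.1 (x k).1.2.1 := by
        linarith [(abs_le.1 (htb k)).2]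
      have hcomp := components_le (hR k).1
      have h2 := hμA ((x k).1.1, (x k).1.2.1) ⟨by
        rw [mem_closedBall_zero_iff, Prod.norm_def]
        exact max_le hcomp.1 hcomp.2.1, h1⟩
      have h3 := mul_le_mul_of_nonneg_left h2 (hI.step_pos k).le
      have h4 := mul_le_mul_of_nonneg_left
        (add_le_add hεk.le (min_le_left (μ / 4) (δ / (R + 1)))) (hI.step_pos k).le
      simp only at h3
      linarith
    · have hlim : Tendsto (fun k => h k * (ε k + b)) atTop (𝓝 0) := by
        simpa using hI.step_lim.mul (hε.add_const b)
      filter_upwards [hstep b hb0, hlim.eventually (gt_mem_nhds hδ)] with k hk hεk hlt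
      have h1 : 0 ≤ h k * (κ / 2 * ‖(x k).1.2.1‖ ^ 2 + c / 2 * ‖∇ Ψ (x k).1.1‖ ^ 2) :=
        mul_nonneg (hI.step_pos k).le (by positivity)
      linarith
  filter_upwards [hev] with k hk
  linarith [(abs_le.1 (htb k)).1]

theorem eventually_timer_le (hI : IsHeavyBallIteration Ψ κ T h x w) (hT : 0 < T) {δ : ℝ}
    (hδ : 0 < δ) : ∀ᶠ k in atTop, (x k).1.2.2 ≤ 2 * T + 2 * δ := by
  have hle : ∀ k, (x (k + 1)).1.2.2 ≤
      (x k).1.2.2 + h k * min 1 (2 - (x k).1.2.2 / T) := by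
    intro k
    rw [← hI.flow_timer]
    rcases hI.next_timer k with e | ⟨e, h⟩ <;> linarith
  refine eventually_le_of_drift (a := 2 * T + δ) (β := δ / T) (h := h)
    (Eventually.of_forall fun k => (hI.step_pos k).le) hI.step_sum (by positivity)
    (by linarith) ?_ ?_
  · refine Eventually.of_forall fun k hk => (hle k).trans ?_
    have h1 : 2 - (x k).1.2.2 / T ≤ -(δ / T) := by
      have : (2 * T + δ) / T ≤ (x k).1.2.2 / T := div_le_div_of_nonneg_right hk hT.le
      rw [add_div, mul_div_assoc, div_self hT.ne'] at this
      linarith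
    have h2 := mul_le_mul_of_nonneg_left ((min_le_right 1 _).trans h1) (hI.step_pos k).le
    linarith
  · filter_upwards [hI.step_lim.eventually (gt_mem_nhds hδ)] with k hk hlt
    have h2 := mul_le_mul_of_nonneg_left (min_le_left 1 (2 - (x k).1.2.2 / T))
      (hI.step_pos k).le
    linarith [hle k]

/-- Below zero the timer advances at rate one, and once the steps are shorter than `T` a step from
there cannot reach the jump set. -/
theorem eventually_timer_ge (hI : IsHeavyBallIteration Ψ κ T h x w) (hT : 0 < T) {δ : ℝ}
    (hδ : 0 < δ) : ∀ᶠ k in atTop, -(2 * δ) ≤ (x k).1.2.2 := by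
  have key : ∀ᶠ k in atTop, -(x k).1.2.2 ≤ 2 * δ := by
    refine eventually_le_of_drift (a := δ) (β := 1) (h := h)
      (Eventually.of_forall fun k => (hI.step_pos k).le) hI.step_sum one_pos (by linarith) ?_ ?_
    · filter_upwards [hI.step_lim.eventually (gt_mem_nhds hT)] with k hk hge
      have h1 : min 1 (2 - (x k).1.2.2 / T) = 1 := by
        have : (x k).1.2.2 / T ≤ 0 := div_nonpos_of_nonpos_of_nonneg (by linarith) hT.le
        exact min_eq_left (by linarith)
      have h2 := hI.flow_timer k
      rw [h1] at h2
      rcases hI.next_timer k with e | ⟨e, h⟩ <;> linarith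
    · obtain ⟨R, hR⟩ := hI.bounded
      have hlim : Tendsto (fun k => h k * (R / T)) atTop (𝓝 0) := by
        simpa using hI.step_lim.mul_const (R / T)
      filter_upwards [hlim.eventually (gt_mem_nhds hδ)] with k hk hlt
      have h1 : -(R / T) ≤ min 1 (2 - (x k).1.2.2 / T) := by
        have hRt := components_le (hR k).1
        have h0 : 0 ≤ R / T := div_nonneg ((norm_nonneg _).trans hRt.1) hT.le
        have := div_le_div_of_nonneg_right ((le_abs_self _).trans hRt.2.2.1) hT.le
        exact le_min (by linarith) (by linarith)
      have h2 := mul_le_mul_of_nonneg_left h1 (hI.step_pos k).le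
      have h3 := hI.flow_timer k
      rcases hI.next_timer k with e | ⟨e, h⟩ <;> linarith
  filter_upwards [key] with k hk
  linarith

theorem flow_increment_tendsto (hI : IsHeavyBallIteration Ψ κ T h x w) :
    Tendsto (fun k => (w k).1 - (x k).1) atTop (𝓝 0) := by
  obtain ⟨R, hR⟩ := hI.bounded
  have hF : ∀ k, ‖flowHB κ T (x k).1 (x k).2‖ ≤ R + (|κ| * R + R) + (1 + (2 + R / |T|)) := by
    intro k
    obtain ⟨-, hp, ht, hξ⟩ := components_le (hR k).1
    have hR0 : 0 ≤ R := (norm_nonneg _).trans hp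
    have h1 : ‖-(κ • (x k).1.2.1) - (x k).2‖ ≤ |κ| * R + R := by
      refine (norm_sub_le _ _).trans (add_le_add ?_ hξ)
      rw [norm_neg, norm_smul, Real.norm_eq_abs]
      exact mul_le_mul_of_nonneg_left hp (abs_nonneg κ)
    have h2 : |min 1 (2 - (x k).1.2.2 / T)| ≤ 1 + (2 + R / |T|) := by
      have h3 : |(x k).1.2.2 / T| ≤ R / |T| := by
        rw [abs_div]; exact div_le_div_of_nonneg_right ht (abs_nonneg T)
      have h4 : 0 ≤ R / |T| := div_nonneg hR0 (abs_nonneg T)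
      rw [abs_le] at h3 ⊢
      exact ⟨le_min (by linarith) (by linarith), (min_le_left _ _).trans (by linarith)⟩
    have h3 : 0 ≤ |κ| * R + R := (norm_nonneg _).trans h1
    have h4 : 0 ≤ 1 + (2 + R / |T|) := (abs_nonneg _).trans h2
    rw [flowHB, Prod.norm_def, Prod.norm_def, Real.norm_eq_abs]
    exact max_le (by simp only; linarith) (max_le (by simp only; linarith)
      (by simp only; linarith))
  refine squeeze_zero_norm (fun k => ?_)
    (by simpa using hI.step_lim.mul_const (R + (|κ| * R + R) + (1 + (2 + R / |T|))))
  rw [hI.flow, add_sub_cancel_left, norm_smul, Real.norm_of_nonneg (hI.step_pos k).le]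
  exact mul_le_mul_of_nonneg_left (hF k) (hI.step_pos k).le

/-- The iterates end up in every neighborhood `Ψ ≤ m + δ`, `‖p‖ ≤ δ`, `-δ ≤ τ ≤ 2T + δ` of the
attractor. -/
theorem eventually_near (hI : IsHeavyBallIteration Ψ κ T h x w) (hκ : 0 < κ) (hT : 0 < T)
    (hdiff : ContDiff ℝ 1 Ψ) (hLip : ∃ L : ℝ≥0, LipschitzWith L (∇ Ψ)) {m : ℝ}
    (hm : ∀ q, m ≤ Ψ q) (hcrit : ∀ q, ∇ Ψ q = 0 → Ψ q = m) {δ : ℝ} (hδ : 0 < δ) :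
    ∀ᶠ k in atTop, ∀ χ ∈ ({(x (k + 1)).1, (w k).1} : Set (SlowState n)),
      Ψ χ.1 ≤ m + δ ∧ ‖χ.2.1‖ ≤ δ ∧ -δ ≤ χ.2.2 ∧ χ.2.2 ≤ 2 * T + δ := by
  obtain ⟨L₀, hL₀⟩ := hLip
  set L : ℝ := L₀ + 1 with hLdef
  have hL : 0 < L := by positivity
  have hLip : ∀ x y, ‖∇ Ψ x - ∇ Ψ y‖ ≤ L * ‖x - y‖ := fun x y =>
    (hL₀.norm_sub_le x y).trans
      (mul_le_mul_of_nonneg_right (by linarith) (norm_nonneg _))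
  -- Then `c(L + κ²/2) = κ/4`, while `4Lc ≤ κ` and `cκ ≤ 1/2` give `8Lc² ≤ 1`.
  set c : ℝ := κ / (4 * L + 2 * κ ^ 2) with hcdef
  have hden : 0 < 4 * L + 2 * κ ^ 2 := by positivity
  have hc : 0 < c := by positivity
  have hceq : c * (4 * L + 2 * κ ^ 2) = κ := div_mul_cancel₀ κ hden.ne'
  have hcκ : c * (L + κ ^ 2 / 2) ≤ κ / 2 := by linarith
  have hcL : 8 * L * c ^ 2 ≤ 1 := by
    have h1 : c * κ ≤ 1 / 2 := by
      have h0 : 0 < c * L := mul_pos hc hL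
      have : (c * κ) * κ ≤ 1 / 2 * κ := by nlinarith
      exact le_of_mul_le_mul_right this hκ
    have h2 : c * (4 * L) ≤ κ := by nlinarith [mul_pos hc (pow_pos hκ 2)]
    nlinarith [mul_le_mul_of_nonneg_left h2 hc.le]
  -- Energy at most `m + 4η` forces `Ψ - m ≤ 8η ≤ δ` and `‖p‖² ≤ 16η ≤ δ²/4`.
  set η : ℝ := min (δ / 8) (δ ^ 2 / 64) with hη
  have hη0 : 0 < η := lt_min (by positivity) (by positivity)
  have hηδ : η ≤ δ / 8 := min_le_left _ _
  have hηδ2 : η ≤ δ ^ 2 / 64 := min_le_right _ _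
  have hx : ∀ᶠ k in atTop, Ψ (x k).1.1 ≤ m + δ ∧ ‖(x k).1.2.1‖ ≤ δ / 2 ∧
      -(δ / 2) ≤ (x k).1.2.2 ∧ (x k).1.2.2 ≤ 2 * T + δ / 2 := by
    filter_upwards [hI.eventually_energy_le hκ hT hdiff hL.le hLip hcrit hc hcκ hη0,
      hI.eventually_timer_le hT (by positivity : 0 < δ / 4),
      hI.eventually_timer_ge hT (by positivity : 0 < δ / 4)] with k h1 h2 h3
    have h4 := crossEnergy_lower_bound (hdiff.differentiable one_ne_zero) hL hLip hm hc.le hcL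
      (x k).1.1 (x k).1.2.1
    have h5 := hm (x k).1.1
    refine ⟨by nlinarith [sq_nonneg ‖(x k).1.2.1‖], ?_, by linarith, by linarith⟩
    refine abs_le_of_sq_le_sq' ?_ (by positivity) |>.2
    linarith
  have hincr := hI.flow_increment_tendsto.eventually (Metric.ball_mem_nhds 0
    (by positivity : 0 < δ / 2))
  filter_upwards [hx, (tendsto_add_atTop_nat 1).eventually hx, hincr] with k hk hk1 hk2
  rintro χ (rfl | rfl)
  · exact ⟨hk1.1, by linarith, by linarith, by linarith⟩
  · rw [dist_zero_right] at hk2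
    have h2 := (norm_snd_le ((w k).1 - (x k).1)).trans hk2.le
    have h3 : ‖(w k).1.2.1 - (x k).1.2.1‖ ≤ δ / 2 := (norm_fst_le _).trans h2
    have h4 : |(w k).1.2.2 - (x k).1.2.2| ≤ δ / 2 := (norm_snd_le _).trans h2
    have h5 := norm_le_norm_add_norm_sub' (w k).1.2.1 (x k).1.2.1
    rw [abs_le] at h4
    refine ⟨?_, by linarith, by linarith, by linarith⟩
    rw [← hI.next_position]
    exact hk1.1

end IsHeavyBallIteration

/-! ### The simulator follows the heavy ball system -/

theorem ObjectiveAssumption.exists_minimum {n N : ℕ} {Ψ : EuclideanSpace ℝ (Fin n) → ℝ}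
    {Ψi : Fin N → EuclideanSpace ℝ (Fin n) → ℝ} (hΨ : ObjectiveAssumption Ψ Ψi) :
    ∃ q, q ∈ minimizers Ψ := by
  obtain ⟨q, hq, hmin⟩ := (hΨ.compact_sublevel (Ψ 0)).exists_isMinOn ⟨0, le_refl (Ψ 0)⟩
    hΨ.contDiff.continuous.continuousOn
  refine ⟨q, fun q' => ?_⟩
  rcases le_total (Ψ q') (Ψ 0) with h | h
  · exact hmin h
  · exact le_trans hq h

theorem isClosed_simC {n : ℕ} (T : ℝ) : IsClosed (simC (n := n) T) := by
  have h1 : Continuous fun x : FullState n => inner ℝ x.2 x.1.2.1 := by fun_prop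
  have h2 : Continuous fun x : FullState n => x.1.2.2 := by fun_prop
  exact ((isClosed_le h1 continuous_const).inter (isClosed_le continuous_const h2)).union
    (isClosed_le h2 continuous_const)

theorem isClosed_simD {n : ℕ} (T : ℝ) : IsClosed (simD (n := n) T) := by
  have h1 : Continuous fun x : FullState n => inner ℝ x.2 x.1.2.1 := by fun_prop
  have h2 : Continuous fun x : FullState n => x.1.2.2 := by fun_prop
  exact (isClosed_le continuous_const h1).inter (isClosed_le continuous_const h2)

theorem continuous_flowHB {n : ℕ} (κ T : ℝ) :
    Continuous fun z : FullState n => flowHB κ T z.1 z.2 := by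
  unfold flowHB
  fun_prop

theorem continuous_jumpHB {n : ℕ} : Continuous (jumpHB (n := n)) := by
  unfold jumpHB
  fun_prop

/-- If the slow parts converge and the fast parts track the gradient, the full states converge
to the slow manifold. -/
theorem tendsto_full_of_slow {n : ℕ} {Ψ : EuclideanSpace ℝ (Fin n) → ℝ}
    (hg : Continuous (∇ Ψ)) {v : ℕ → FullState n} {χ : SlowState n}
    (hv : Tendsto (fun k => (v k).1) atTop (𝓝 χ))
    (htrack : Tendsto (fun k => (v k).2 - ∇ Ψ (v k).1.1) atTop (𝓝 0)) :
    Tendsto v atTop (𝓝 (χ, ∇ Ψ χ.1)) := by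
  have h1 : Tendsto (fun k => ∇ Ψ (v k).1.1) atTop (𝓝 (∇ Ψ χ.1)) :=
    (hg.tendsto _).comp ((continuous_fst.tendsto _).comp hv)
  have h2 := htrack.add h1
  simp only [sub_add_cancel, zero_add] at h2
  exact hv.prodMk_nhds h2

namespace IsSimulatorSolution

variable {n N : ℕ} {Ω : Type*}
  {Ψ : EuclideanSpace ℝ (Fin n) → ℝ} {Ψi : Fin N → EuclideanSpace ℝ (Fin n) → ℝ} {κ T : ℝ}
  {hs hf : ℕ → ℝ} {y : ℕ → Ω → Fin N} {X : Ω → HybridSeq (FullState n)}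

theorem isHeavyBallIteration (hX : IsSimulatorSolution Ψi κ T hs hf y X) (hT : 0 < T)
    (hs_adm : AdmissibleSteps hs) {ω : Ω} (hb : (X ω).IsBounded)
    (htrack : Tendsto (fun k => ((X ω).flowStart k).2 - ∇ Ψ ((X ω).flowStart k).1.1)
      atTop (𝓝 0)) :
    IsHeavyBallIteration Ψ κ T (fun k => hs (k + 1)) (X ω).flowStart (X ω).flowEnd where
  step_pos k := hs_adm.pos _ (by omega)
  step_lim := (tendsto_add_atTop_iff_nat 1).2 hs_adm.tendsto_zero
  step_sum := hs_adm.not_summable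
  flow := hX.flowEnd_fst hT hs_adm.pos ω
  next := hX.flowStart_succ hT ω
  bounded := hX.exists_bound hT hb
  tracking := htrack

theorem omegaLim_subset (hX : IsSimulatorSolution Ψi κ T hs hf y X) (hκ : 0 < κ) (hT : 0 < T)
    (hΨ : ObjectiveAssumption Ψ Ψi) (hs_adm : AdmissibleSteps hs) {ω : Ω}
    (hb : (X ω).IsBounded)
    (htrack : Tendsto (fun k => ((X ω).flowStart k).2 - ∇ Ψ ((X ω).flowStart k).1.1)
      atTop (𝓝 0)) :
    ((X ω).map Prod.fst).omegaLim ⊆ attractorHB Ψ T := by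
  have hI := hX.isHeavyBallIteration hT hs_adm hb htrack
  obtain ⟨q₀, hq₀⟩ := hΨ.exists_minimum
  have hcrit : ∀ q, ∇ Ψ q = 0 → Ψ q = Ψ q₀ := by
    intro q hq
    have : q ∈ minimizers Ψ := by rw [hΨ.minimizers_eq]; exact hq
    exact le_antisymm (this q₀) (hq₀ q)
  intro χ hχ
  have key : ∀ δ : ℝ, 0 < δ →
      Ψ χ.1 ≤ Ψ q₀ + δ ∧ ‖χ.2.1‖ ≤ δ ∧ -δ ≤ χ.2.2 ∧ χ.2.2 ≤ 2 * T + δ := by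
    intro δ hδ
    obtain ⟨K, hK⟩ := eventually_atTop.1
      (hI.eventually_near hκ hT hΨ.contDiff hΨ.lipschitz_gradient hq₀ hcrit hδ)
    have hclosed : IsClosed {χ : SlowState n |
        Ψ χ.1 ≤ Ψ q₀ + δ ∧ ‖χ.2.1‖ ≤ δ ∧ -δ ≤ χ.2.2 ∧ χ.2.2 ≤ 2 * T + δ} := by
      have hc : Continuous fun χ : SlowState n => Ψ χ.1 :=
        hΨ.contDiff.continuous.comp continuous_fst
      have h1 : Continuous fun χ : SlowState n => ‖χ.2.1‖ := by fun_prop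
      have h2 : Continuous fun χ : SlowState n => χ.2.2 := by fun_prop
      exact (isClosed_le hc continuous_const).inter ((isClosed_le h1 continuous_const).inter
        ((isClosed_le continuous_const h2).inter (isClosed_le h2 continuous_const)))
    -- From `k + j ≥ 2K + 3` and `j ≤ k + 1` follows `k ≥ K + 1`, so the point lies in a column `k'
    -- + 1` with `k' ≥ K`.
    refine closure_minimal ?_ hclosed (Set.mem_iInter.1 hχ (2 * K + 3))
    rintro _ ⟨⟨k, j⟩, hz, hkj, rfl⟩
    have hj := (hX.noDoubleJump hT ω).le_succ hz
    simp only at hkj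
    obtain ⟨k', rfl⟩ := Nat.exists_eq_add_of_le' (show 1 ≤ k by omega)
    refine hK k' (by omega) _ ?_
    rcases (hX.noDoubleJump hT ω).eq_jbar_or (hX.isCompleteK hT ω) hz with e | e
    · right
      simp only [HybridSeq.map, HybridSeq.flowEnd, e, Set.mem_singleton_iff]
    · left
      simp only [HybridSeq.map, HybridSeq.flowStart, e]
  refine ⟨fun q' => ?_, ?_, ?_, ?_⟩
  · exact (le_of_forall_pos_le_add fun δ hδ => (key δ hδ).1).trans (hq₀ q')
  · have h0 : ‖χ.2.1‖ ≤ 0 := le_of_forall_pos_le_add fun δ hδ => by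
      rw [zero_add]; exact (key δ hδ).2.1
    exact norm_le_zero_iff.1 h0
  · exact le_of_forall_pos_le_add fun δ hδ => by linarith [(key δ hδ).2.2.1]
  · exact le_of_forall_pos_le_add fun δ hδ => (key δ hδ).2.2.2

theorem isAsymptoticSimulation (hX : IsSimulatorSolution Ψi κ T hs hf y X) (hT : 0 < T)
    (hΨ : ObjectiveAssumption Ψ Ψi) (hs_adm : AdmissibleSteps hs) {ω : Ω}
    (hb : (X ω).IsBounded)
    (htrack : Tendsto (fun k => ((X ω).flowStart k).2 - ∇ Ψ ((X ω).flowStart k).1.1)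
      atTop (𝓝 0)) :
    IsAsymptoticSimulation (heavyBall Ψ κ T) ((X ω).map Prod.fst) hs where
  bounded := by
    obtain ⟨R, hR⟩ := Bornology.IsBounded.exists_norm_le hb
    refine isBounded_iff_forall_norm_le.2 ⟨R, ?_⟩
    rintro _ ⟨z, hz, h0, rfl⟩
    exact (norm_fst_le _).trans (hR _ ⟨z, hz, h0, rfl⟩)
  complete := hX.complete ω
  admissible := hs_adm
  flow := by
    intro _
    have hg := hΨ.contDiff.continuous_gradient
    -- With the simulator's own direction as `f`, every summand of the defect is zero. Only the
    -- accumulation points need tracking, which replaces `ξ` by `∇Ψ(q)` in the limit.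
    refine ⟨fun k => flowHB κ T ((X ω).flowStart k).1 ((X ω).flowStart k).2, ?_, ?_, ?_⟩
    · obtain ⟨R, hR⟩ := hX.exists_bound hT hb
      refine ((isCompact_closedBall (0 : FullState n) R).image
        (continuous_flowHB κ T)).isBounded.subset ?_
      rintro _ ⟨k, rfl⟩
      exact ⟨(X ω).flowStart k, mem_closedBall_zero_iff.2 (hR k).1, rfl⟩
    · rintro ⟨χ, f⟩ hz
      obtain ⟨ψ, hψ, hlim⟩ := MapClusterPt.tendsto_subseq hz
      have h1 : Tendsto (fun k => ((X ω).flowStart (ψ k)).1) atTop (𝓝 χ) :=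
        (continuous_fst.tendsto _).comp hlim
      have h2 := (continuous_snd.tendsto _).comp hlim
      have h3 := tendsto_full_of_slow hg h1 (htrack.comp hψ.tendsto_atTop)
      have h4 := ((continuous_flowHB κ T).tendsto _).comp h3
      exact ⟨(isClosed_simC T).mem_of_tendsto h3
        (Eventually.of_forall fun k => hX.flowStart_mem hT ω _), tendsto_nhds_unique h2 h4⟩
    · intro S hS
      refine tendsto_const_nhds.congr fun l => Eq.symm ?_
      refine le_antisymm (Finset.sup_le fun k hk => ?_) bot_le
      rw [Finset.sum_eq_zero fun i _ => ?_, nnnorm_zero]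
      have hpos := (hs_adm.pos (i + 1) (by omega)).ne'
      have e : ((X ω).map Prod.fst).val (i + 1) (((X ω).map Prod.fst).jbar i) -
          ((X ω).map Prod.fst).val i (((X ω).map Prod.fst).jbar i) =
          ((X ω).flowEnd i).1 - ((X ω).flowStart i).1 := rfl
      rw [e, hX.flowEnd_fst hT hs_adm.pos ω i, add_sub_cancel_left, inv_smul_smul₀ hpos,
        sub_self, smul_zero]
  jump := by
    intro hJ
    have hJ' : (X ω).IsCompleteJ := hJ
    have hg := hΨ.contDiff.continuous_gradient
    have hmem := hJ'.kbar_mem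
    -- Because `j ≤ k + 1`, late jumps occur in late columns, where tracking applies.
    have hk : Tendsto (X ω).kbar atTop atTop := by
      refine tendsto_atTop.2 fun m => ?_
      filter_upwards [eventually_ge_atTop (m + 1)] with j hj
      have := (hX.noDoubleJump hT ω).le_succ (hmem j).1
      omega
    have htrack' : Tendsto (fun j => ((X ω).val ((X ω).kbar j) j).2 -
        ∇ Ψ ((X ω).val ((X ω).kbar j) j).1.1) atTop (𝓝 0) := by
      refine (htrack.comp hk).congr fun j => ?_
      rw [hX.position_eq hT ω (hmem j).1, hX.fast_eq hT ω (hmem j).1]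
      rfl
    rintro ⟨χ, g⟩ hz
    obtain ⟨ψ, hψ, hlim⟩ := MapClusterPt.tendsto_subseq hz
    have h1 : Tendsto (fun j => ((X ω).val ((X ω).kbar (ψ j)) (ψ j)).1) atTop (𝓝 χ) :=
      (continuous_fst.tendsto _).comp hlim
    have h2 : Tendsto (fun j => ((X ω).val ((X ω).kbar (ψ j)) (ψ j + 1)).1) atTop (𝓝 g) :=
      (continuous_snd.tendsto _).comp hlim
    have h3 := tendsto_full_of_slow hg h1 (htrack'.comp hψ.tendsto_atTop)
    have h4 := (continuous_jumpHB.tendsto _).comp h1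
    refine ⟨(isClosed_simD T).mem_of_tendsto h3 (Eventually.of_forall fun j =>
      (hX.jump ω _ _ (hmem _).1 (hmem _).2).1), tendsto_nhds_unique h2 (h4.congr fun j => ?_)⟩
    exact (hX.jump ω _ _ (hmem _).1 (hmem _).2).2.1.symm

end IsSimulatorSolution

theorem mainTheorem4 {n N : ℕ} {Ω : Type*} [MeasurableSpace Ω]
    (P : Measure Ω) [IsProbabilityMeasure P]
    (Ψ : EuclideanSpace ℝ (Fin n) → ℝ) (Ψi : Fin N → EuclideanSpace ℝ (Fin n) → ℝ)
    (hΨ : ObjectiveAssumption Ψ Ψi)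
    (κ T : ℝ) (hκ : 0 < κ) (hT : 0 < T)
    (hs hf : ℕ → ℝ) (hsteps : SimulatorSteps hs hf)
    (y : ℕ → Ω → Fin N) (hy : IsUniformIID P y)
    (X : Ω → HybridSeq (FullState n)) (hX : IsSimulatorSolution Ψi κ T hs hf y X)
    (Ωhat : Set Ω)
    (hΩhat : ∀ᵐ ω ∂P, ω ∈ Ωhat → (X ω).IsBounded ∧ (X ω).IsComplete) :
    ∀ᵐ ω ∂P, ω ∈ Ωhat →
      IsAsymptoticSimulation (heavyBall Ψ κ T) ((X ω).map Prod.fst) hs ∧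
      ((X ω).map Prod.fst).omegaLim ⊆ attractorHB Ψ T := by
  filter_upwards [hΩhat, hX.tracking hT hΨ hsteps hy] with ω hω htrack hmem
  have hb := (hω hmem).1
  exact ⟨hX.isAsymptoticSimulation hT hΨ hsteps.admissible.slow hb (htrack hb),
    hX.omegaLim_subset hκ hT hΨ hsteps.admissible.slow hb (htrack hb)⟩
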